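/- For $p\in(0,1/2)$ let $c_p>0$ be the unique real number with $\mathbb{P}[Z\le -c_p]=p$, where $Z\sim\mathcal N(0,1)$. For positive integers $n,d$, the Gaussian random geometric graph $G(n,d,p)$ has vertex set $[n]$; its vertices correspond to independent random vectors $\boldsymbol x_1,\dots,\boldsymbol x_n\sim\mathcal N(0,\frac1d I_d)$ in $\mathbb R^d$, and distinct $i,j$ are joined by an edge if and only if $\langle\boldsymbol x_i,\boldsymbol x_j\rangle\ge -c_p/\sqrt d$. Edges are coloured blue and non-edges red; write $P_{\mathrm{red},r}=\mathbb P[G(r,d,p)\text{ is an independent set}]$ and $P_{\mathrm{blue},r}=\mathbb P[G(r,d,p)\text{ is a clique}]$. Lemma 3. Let $C>1$ be a constant and let $p_C\in(0,1/2)$ be the unique solution of $C=\frac{\log p_C}{\log(1-p_C)}$. There is $D_0=D_0(C)>0$ such that for every real $D\ge D_0$ there exist $\varepsilon_1\in(0,p_C)$ and $p\in(0,1/2)$, depending only on $C$ and $D$, such that for all integers $\ell$ that are sufficiently large in terms of $C$ and $D$, with $d=D^2\ell^2$, $$P_{\mathrm{red},\ell}\le (p_C-\varepsilon_1)^{\binom{\ell}{2}}\quad\text{and}\quad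 P_{\mathrm{blue},C\ell}\le(1-p_C-\varepsilon_1)^{\binom{C\ell}{2}}.$$ Where $D^2\ell^2$ or $C\ell$ is not an integer, it may be replaced by either of the two integers nearest to it from below and above. -/

import Mathlib

open MeasureTheory ProbabilityTheory

namespace GaussRamsey

/-! ### The Erdős probability `p_C` -/

/-- `q` lies in `(0, 1/2)` and solves `C = log q / log (1 - q)`. -/
def IsErdosProb (C q : ℝ) : Prop :=
  0 < q ∧ q < 1 / 2 ∧ C = Real.log q / Real.log (1 - q)

theorem isErdosProb_iff {C q : ℝ} (h0 : 0 < q) (h1 : q < 1 / 2) :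
    IsErdosProb C q ↔ Real.log q - C * Real.log (1 - q) = 0 := by
  have hl : Real.log (1 - q) < 0 := Real.log_neg (by linarith) (by linarith)
  unfold IsErdosProb
  rw [eq_div_iff hl.ne]
  constructor
  · rintro ⟨-, -, h⟩
    linarith
  · intro h
    exact ⟨h0, h1, by linarith⟩

theorem existsUnique_isErdosProb {C : ℝ} (hC : 1 < C) : ∃! q : ℝ, IsErdosProb C q := by
  have hl2 : 0 < Real.log 2 := Real.log_pos (by norm_num)
  have hhalf : Real.log (1 / 2) = -Real.log 2 := by rw [one_div, Real.log_inv]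
  let g : ℝ → ℝ := fun q => Real.log q - C * Real.log (1 - q)
  have hmono : ∀ x y : ℝ, 0 < x → x < y → y ≤ 1 / 2 → g x < g y := by
    intro x y hx hxy hy
    have h1 : Real.log x < Real.log y := Real.log_lt_log hx hxy
    have h2 : Real.log (1 - y) < Real.log (1 - x) :=
      Real.log_lt_log (by linarith) (by linarith)
    simp only [g]
    nlinarith
  let q₀ : ℝ := Real.exp (-(C + 1) * Real.log 2)
  have hq₀ : 0 < q₀ := Real.exp_pos _
  have hlq₀ : Real.log q₀ = -(C + 1) * Real.log 2 := Real.log_exp _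
  have hq₀' : q₀ < 1 / 2 := by
    rw [← Real.log_lt_log_iff hq₀ (by norm_num), hlq₀, hhalf]
    nlinarith
  have hg0 : g q₀ < 0 := by
    have : Real.log (1 / 2) ≤ Real.log (1 - q₀) :=
      Real.log_le_log (by norm_num) (by linarith)
    simp only [g]
    rw [hlq₀]
    rw [hhalf] at this
    nlinarith
  have hg1 : 0 < g (1 / 2) := by
    simp only [g]
    rw [show (1 - 1 / 2 : ℝ) = 1 / 2 by norm_num, hhalf]
    nlinarith
  have hcont : ContinuousOn g (Set.Icc q₀ (1 / 2)) := by
    apply ContinuousOn.sub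
    · exact Real.continuousOn_log.mono fun x hx => (lt_of_lt_of_le hq₀ hx.1).ne'
    · refine continuousOn_const.mul (ContinuousOn.log (by fun_prop) ?_)
      intro x hx
      have := hx.2
      linarith
  obtain ⟨q, hq, hgq⟩ := intermediate_value_Ioo hq₀'.le hcont ⟨hg0, hg1⟩
  have hqpos : 0 < q := hq₀.trans hq.1
  refine ⟨q, (isErdosProb_iff hqpos hq.2).2 hgq, ?_⟩
  intro y hy
  have hgy : g y = 0 := (isErdosProb_iff hy.1 hy.2.1).1 hy
  rcases lt_trichotomy y q with h | h | h
  · have := hmono y q hy.1 h hq.2.le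
    linarith
  · exact h
  · have := hmono q y hqpos h hy.2.1.le
    linarith

/-- `p_C`: the solution `q ∈ (0, 1/2)` of `C = log q / log (1 - q)`. -/
noncomputable def erdosProb (C : ℝ) : ℝ :=
  Classical.epsilon fun q : ℝ => IsErdosProb C q

theorem erdosProb_spec {C : ℝ} (hC : 1 < C) : IsErdosProb C (erdosProb C) :=
  Classical.epsilon_spec (existsUnique_isErdosProb hC).exists

/-! ### The threshold `c_p` -/

/-- `c > 0` and `P[Z ≤ -c] = p` for a standard normal variable `Z`. -/
def IsGaussThreshold (p c : ℝ) : Prop :=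
  0 < c ∧ (gaussianReal 0 1).real (Set.Iic (-c)) = p

theorem gaussianReal_Iic_strictMono :
    StrictMono fun x : ℝ => (gaussianReal 0 1).real (Set.Iic x) := by
  intro x y hxy
  have hpos : 0 < (gaussianReal 0 1).real (Set.Ioc x y) := by
    refine ENNReal.toReal_pos ?_ (measure_ne_top _ _)
    intro h0
    have := gaussianReal_absolutelyContinuous' 0 one_ne_zero h0
    rw [Real.volume_Ioc, ENNReal.ofReal_eq_zero] at this
    linarith
  have hsplit : (gaussianReal 0 1).real (Set.Iic y)
      = (gaussianReal 0 1).real (Set.Iic x) + (gaussianReal 0 1).real (Set.Ioc x y) := by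
    rw [← measureReal_union _ measurableSet_Ioc, Set.Iic_union_Ioc_eq_Iic hxy.le]
    exact Set.disjoint_left.2 fun z hz hz' => not_lt.2 hz hz'.1
  simp only
  linarith

theorem gaussianReal_Iic_continuous :
    Continuous fun x : ℝ => (gaussianReal 0 1).real (Set.Iic x) := by
  have hcdf : (fun x : ℝ => (gaussianReal 0 1).real (Set.Iic x)) = cdf (gaussianReal 0 1) := by
    funext x
    exact (cdf_eq_real _ x).symm
  rw [hcdf, continuous_iff_continuousAt]
  intro x
  have hna := nullSingletonClass_gaussianReal (μ := 0) (v := 1) one_ne_zero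
  have h : (cdf (gaussianReal 0 1)).measure {x} = 0 := by
    rw [measure_cdf]
    exact measure_singleton x
  rw [StieltjesFunction.measure_singleton, ENNReal.ofReal_eq_zero] at h
  rw [(monotone_cdf _).continuousAt_iff_leftLim_eq_rightLim, StieltjesFunction.rightLim_eq]
  exact le_antisymm ((monotone_cdf _).leftLim_le le_rfl) (by linarith)

theorem gaussianReal_Iic_zero : (gaussianReal 0 1).real (Set.Iic 0) = 1 / 2 := by
  have hna := nullSingletonClass_gaussianReal (μ := 0) (v := 1) one_ne_zero
  have h1 : (gaussianReal 0 1).real (Set.Iic 0) = (gaussianReal 0 1).real (Set.Ioi 0) := by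
    have hneg : (gaussianReal 0 1).map (fun x : ℝ => -x) = gaussianReal 0 1 := by
      rw [gaussianReal_map_neg, neg_zero]
    calc (gaussianReal 0 1).real (Set.Iic 0)
        = ((gaussianReal 0 1).map (fun x : ℝ => -x)).real (Set.Iic 0) := by rw [hneg]
      _ = (gaussianReal 0 1).real (Set.Ici 0) := by
          rw [map_measureReal_apply measurable_neg measurableSet_Iic]
          congr 1
          ext z
          simp
      _ = (gaussianReal 0 1).real (Set.Ioi 0) := measureReal_congr Ioi_ae_eq_Ici.symm
  have h2 : (gaussianReal 0 1).real (Set.Iic 0) + (gaussianReal 0 1).real (Set.Ioi 0) = 1 := by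
    rw [← Set.compl_Iic, probReal_compl_eq_one_sub measurableSet_Iic]
    ring
  linarith

theorem existsUnique_isGaussThreshold {p : ℝ} (h0 : 0 < p) (h1 : p < 1 / 2) :
    ∃! c : ℝ, IsGaussThreshold p c := by
  have hlim : Filter.Tendsto (fun x : ℝ => (gaussianReal 0 1).real (Set.Iic x))
      Filter.atBot (nhds 0) := by
    refine (tendsto_cdf_atBot (gaussianReal 0 1)).congr fun x => cdf_eq_real _ x
  obtain ⟨x₀, hx₀, hx₀'⟩ :=
    ((hlim.eventually (gt_mem_nhds h0)).and (Filter.eventually_lt_atBot 0)).exists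
  obtain ⟨x, hx, hpx⟩ := intermediate_value_Ioo hx₀'.le gaussianReal_Iic_continuous.continuousOn
    ⟨hx₀, lt_of_lt_of_eq h1 gaussianReal_Iic_zero.symm⟩
  refine ⟨-x, ⟨by have := hx.2; linarith, by simpa using hpx⟩, ?_⟩
  intro y hy
  have := gaussianReal_Iic_strictMono.injective (hy.2.trans hpx.symm)
  linarith

/-- `c_p`: the number `c > 0` with `P[Z ≤ -c] = p`, where `Z ∼ N(0, 1)`. -/
noncomputable def gaussThreshold (p : ℝ) : ℝ :=
  Classical.epsilon fun c : ℝ => IsGaussThreshold p c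

theorem gaussThreshold_spec {p : ℝ} (h0 : 0 < p) (h1 : p < 1 / 2) :
    IsGaussThreshold p (gaussThreshold p) :=
  Classical.epsilon_spec (existsUnique_isGaussThreshold h0 h1).exists

/-! ### The Gaussian random geometric graph `G(n, d, p)` -/

/-- The graph on `[n]` of the vectors `x 1, …, x n ∈ ℝ^d`: distinct `i`, `j` are adjacent if
`⟨x i, x j⟩ ≥ -c_p / √d`. -/
def geomGraph (n d : ℕ) (p : ℝ) (x : Fin n → EuclideanSpace ℝ (Fin d)) :
    SimpleGraph (Fin n) where
  Adj i j := i ≠ j ∧ -(gaussThreshold p) / Real.sqrt d ≤ inner ℝ (x i) (x j)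
  symm := ⟨fun i j h => ⟨h.1.symm, by rw [real_inner_comm]; exact h.2⟩⟩
  loopless := ⟨fun _ h => h.1 rfl⟩

/-- The joint law of `n` independent vectors with distribution `N(0, (1/d) I_d)`. -/
noncomputable def gaussVectors (n d : ℕ) : Measure (Fin n → EuclideanSpace ℝ (Fin d)) :=
  Measure.pi fun _ =>
    multivariateGaussian (0 : EuclideanSpace ℝ (Fin d))
      ((1 / (d : ℝ)) • (1 : Matrix (Fin d) (Fin d) ℝ))

/-- `P_{red, r}`: the probability that all of `G(r, d, p)` is an independent set
(non-edges are red). -/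
noncomputable def probRed (r d : ℕ) (p : ℝ) : ℝ :=
  (gaussVectors r d).real {x | (geomGraph r d p x).IsIndepSet Set.univ}

/-- `P_{blue, r}`: the probability that all of `G(r, d, p)` is a clique (edges are blue). -/
noncomputable def probBlue (r d : ℕ) (p : ℝ) : ℝ :=
  (gaussVectors r d).real {x | (geomGraph r d p x).IsClique Set.univ}

end GaussRamsey

/-!
Expose the vectors one at a time. By rotation invariance the exposed vector may be put on a
coordinate axis; its norm is concentrated around `√d`, it constrains only the first coordinates `z`
of the remaining vectors, and deleting these coordinates leaves the same problem in dimension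
`d - 1`, with the bound for the pair `i, j` changed by the product of `z i` and `z j`. Replacing
`log Φ` by its tangent at `θ`, of slope `h = hazard θ`, makes every bound exponential-linear, so
that the correction appears as the weight `exp (∓κ ∑ z i z j)` with `κ = h / √d`. Since `z i` has
mean `-h` under its constraint, the exponent per pair is `log Φ(θ)` plus, for `n = ρ √d` vectors,
the first-order term `-h³ρ/3` for independent sets and `+h³ρ/3` for cliques.

With `ρ = 1 / D` and `ρ = C / D`, independent sets at the threshold of `p_C` gain `h(-c)³ / 3D`,
and cliques lose `C h(c)³ / 3D`. Lowering the threshold by `η / D` costs independent sets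
`h(-c) η / D` and gives cliques `h(c) η / D`, so both end up ahead if
`C h(c)² < 3 η < h(-c)²`. There is such an `η`, because `h(-c) / h(c) = (1 - q) / q` for `q = p_C`
and `q² log q > (1 - q)² log (1 - q)`.
-/

namespace GaussRamsey

open Filter Real Set
open scoped ENNReal Topology

/-! ### Affine upper bounds for `log Φ` -/

/-- The standard normal distribution function `Φ`. -/
noncomputable def gaussCDF (x : ℝ) : ℝ := (gaussianReal 0 1).real (Iic x)

theorem gaussCDF_pos (x : ℝ) : 0 < gaussCDF x :=
  measureReal_nonneg.trans_lt (gaussianReal_Iic_strictMono (sub_one_lt x))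

theorem gaussCDF_lt_one (x : ℝ) : gaussCDF x < 1 :=
  (gaussianReal_Iic_strictMono (lt_add_one x)).trans_le measureReal_le_one

theorem gaussCDF_neg (x : ℝ) : gaussCDF (-x) = 1 - gaussCDF x := by
  have : NullSingletonClass (gaussianReal 0 1) := nullSingletonClass_gaussianReal one_ne_zero
  have hsymm : (gaussianReal 0 1).map (fun z : ℝ => -z) = gaussianReal 0 1 := by
    rw [gaussianReal_map_neg, neg_zero]
  calc gaussCDF (-x)
      = ((gaussianReal 0 1).map (fun z : ℝ => -z)).real (Iic (-x)) := by rw [hsymm, gaussCDF]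
    _ = (gaussianReal 0 1).real (Ici x) := by
        rw [map_measureReal_apply measurable_neg measurableSet_Iic]
        simp
    _ = (gaussianReal 0 1).real (Iic x)ᶜ := by
        rw [compl_Iic]
        exact measureReal_congr Ioi_ae_eq_Ici.symm
    _ = 1 - gaussCDF x := by rw [probReal_compl_eq_one_sub measurableSet_Iic, gaussCDF]

theorem gaussCDF_eq_integral_Iic (x : ℝ) :
    gaussCDF x = ∫ w in Iic x, gaussianPDFReal 0 1 w := by
  rw [gaussCDF, measureReal_def, gaussianReal_apply_eq_integral _ one_ne_zero,
    ENNReal.toReal_ofReal (integral_nonneg fun _ => gaussianPDFReal_nonneg _ _ _)]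

theorem gaussCDF_eq_integral_Iic_zero (x : ℝ) :
    gaussCDF x = ∫ w in Iic 0, gaussianPDFReal 0 1 (w + x) := by
  rw [gaussCDF_eq_integral_Iic, ← (measurePreserving_add_right volume x).setIntegral_preimage_emb
    (measurableEmbedding_addRight x) (gaussianPDFReal 0 1) (Iic x)]
  simp

theorem hasDerivAt_gaussCDF (x : ℝ) : HasDerivAt gaussCDF (gaussianPDFReal 0 1 x) x := by
  have hcont : Continuous (gaussianPDFReal 0 1) := by
    rw [gaussianPDFReal_def]
    fun_prop
  have hint := integrable_gaussianPDFReal 0 1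
  have hCDF : gaussCDF = fun x => gaussCDF 0 + ∫ w in (0 : ℝ)..x, gaussianPDFReal 0 1 w := by
    ext x
    rw [← intervalIntegral.integral_Iic_sub_Iic hint.integrableOn hint.integrableOn,
      gaussCDF_eq_integral_Iic, gaussCDF_eq_integral_Iic, add_sub_cancel]
  rw [hCDF]
  exact (intervalIntegral.integral_hasDerivAt_right (hcont.intervalIntegrable _ _)
    hcont.stronglyMeasurable.stronglyMeasurableAtFilter hcont.continuousAt).const_add _

theorem gaussianPDFReal_mul_le_of_le {x y w : ℝ} (hxy : x ≤ y) (hw : w ≤ 0) :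
    gaussianPDFReal 0 1 y * gaussianPDFReal 0 1 (w + x)
      ≤ gaussianPDFReal 0 1 x * gaussianPDFReal 0 1 (w + y) := by
  have hexp : exp (-y ^ 2 / 2) * exp (-(w + x) ^ 2 / 2)
      ≤ exp (-x ^ 2 / 2) * exp (-(w + y) ^ 2 / 2) := by
    rw [← exp_add, ← exp_add, exp_le_exp]
    nlinarith
  have hconst : 0 ≤ (√(2 * π))⁻¹ * (√(2 * π))⁻¹ := by positivity
  simp only [gaussianPDFReal_def, NNReal.coe_one, mul_one, sub_zero]
  linarith [mul_le_mul_of_nonneg_left hexp hconst]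

/-- The reversed hazard rate `φ / Φ` of the standard normal law, i.e. the derivative of `log Φ`. -/
noncomputable def hazard (x : ℝ) : ℝ := gaussianPDFReal 0 1 x / gaussCDF x

theorem hazard_pos (x : ℝ) : 0 < hazard x :=
  div_pos (gaussianPDFReal_pos _ _ _ one_ne_zero) (gaussCDF_pos x)

theorem hazard_antitone : Antitone hazard := by
  intro x y hxy
  have hint : ∀ y : ℝ, Integrable fun w => gaussianPDFReal 0 1 (w + y) :=
    (integrable_gaussianPDFReal 0 1).comp_add_right
  rw [hazard, hazard, div_le_div_iff₀ (gaussCDF_pos _) (gaussCDF_pos _),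
    gaussCDF_eq_integral_Iic_zero, gaussCDF_eq_integral_Iic_zero, ← integral_const_mul,
    ← integral_const_mul]
  exact setIntegral_mono_on ((hint x).const_mul _).integrableOn
    ((hint y).const_mul _).integrableOn measurableSet_Iic
    fun w hw => gaussianPDFReal_mul_le_of_le hxy hw

theorem hazard_mul_gaussCDF_neg (c : ℝ) :
    hazard (-c) * gaussCDF (-c) = hazard c * (1 - gaussCDF (-c)) := by
  have hpdf : gaussianPDFReal 0 1 (-c) = gaussianPDFReal 0 1 c := by simp [gaussianPDFReal_def]
  rw [← gaussCDF_neg, neg_neg, hazard, hazard, div_mul_cancel₀ _ (gaussCDF_pos _).ne',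
    div_mul_cancel₀ _ (gaussCDF_pos _).ne', hpdf]

theorem hasDerivAt_log_gaussCDF (x : ℝ) :
    HasDerivAt (fun x => log (gaussCDF x)) (hazard x) x :=
  (hasDerivAt_gaussCDF x).log (gaussCDF_pos x).ne'

theorem concaveOn_log_gaussCDF : ConcaveOn ℝ univ fun x => log (gaussCDF x) := by
  refine Antitone.concaveOn_univ_of_deriv
    (fun x => (hasDerivAt_log_gaussCDF x).differentiableAt) ?_
  rw [funext fun x => (hasDerivAt_log_gaussCDF x).deriv]
  exact hazard_antitone

theorem log_gaussCDF_le_tangent (θ x : ℝ) :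
    log (gaussCDF x) ≤ log (gaussCDF θ) + hazard θ * (x - θ) := by
  rcases lt_trichotomy x θ with h | rfl | h
  · have := concaveOn_log_gaussCDF.le_slope_of_hasDerivAt (mem_univ x) (mem_univ θ) h
      (hasDerivAt_log_gaussCDF θ)
    rw [slope_def_field, le_div_iff₀ (sub_pos.2 h)] at this
    linarith
  · simp
  · have := concaveOn_log_gaussCDF.slope_le_of_hasDerivAt (mem_univ θ) (mem_univ x) h
      (hasDerivAt_log_gaussCDF θ)
    rw [slope_def_field, div_le_iff₀ (sub_pos.2 h)] at this
    linarith

theorem log_gaussCDF_le_chernoff {b : ℝ} (hb : 0 ≤ b) (x : ℝ) :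
    log (gaussCDF x) ≤ b * x + b ^ 2 / 2 := by
  rw [log_le_iff_le_exp (gaussCDF_pos x)]
  have h := measure_le_le_exp_mul_mgf (μ := gaussianReal 0 1) (X := id) x (neg_nonpos.2 hb)
    (integrable_exp_mul_gaussianReal _)
  rw [mgf_id_gaussianReal, ← exp_add] at h
  convert h using 2
  · simp [gaussCDF, Iic]
  · simp

/-- `log Φ` is bounded above by affine functions of every slope `b ≥ 0`, with an intercept that
exceeds `Λ` by an error Lipschitz in `b²` and vanishing at `b = m`. This is the only property of
`Φ` that enters the estimates for high-dimensional Gaussian vectors. -/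
def LogCDFAffineBound (Λ m K : ℝ) : Prop :=
  ∀ b : ℝ, 0 ≤ b → ∀ x, log (gaussCDF x) ≤ Λ + b * x + K * |b ^ 2 - m ^ 2|

-- A slope `b ≤ m` is a convex combination of the slope `m` and the slope `0` of the bound `Φ ≤ 1`.
theorem log_gaussCDF_le_affine_of_le {Λ m b x : ℝ} (hm : 0 < m)
    (hx : log (gaussCDF x) ≤ Λ + m * x) (hb : 0 ≤ b) (hbm : b ≤ m) :
    log (gaussCDF x) ≤ Λ + b * x + |Λ| / m ^ 2 * (m ^ 2 - b ^ 2) := by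
  obtain ⟨β, rfl⟩ : ∃ β, b = β * m := ⟨b / m, by field_simp⟩
  have hβ0 : 0 ≤ β := nonneg_of_mul_nonneg_left hb hm
  have hβ1 : β ≤ 1 := le_of_mul_le_mul_right (by linarith) hm
  have hlog : log (gaussCDF x) ≤ 0 := log_nonpos (gaussCDF_pos x).le (gaussCDF_lt_one x).le
  have hΛ : (1 - β) * -Λ ≤ |Λ| * (1 - β ^ 2) := by
    nlinarith [neg_le_abs Λ, mul_nonneg (abs_nonneg Λ) (mul_nonneg hβ0 (sub_nonneg.2 hβ1))]
  calc log (gaussCDF x) ≤ β * (Λ + m * x) := by nlinarith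
    _ ≤ Λ + β * m * x + |Λ| * (1 - β ^ 2) := by linarith
    _ = Λ + β * m * x + |Λ| / m ^ 2 * (m ^ 2 - (β * m) ^ 2) := by field_simp

-- A slope `b ≥ m` is a convex combination of the slope `m` and of the Chernoff slope `b + m`.
theorem log_gaussCDF_le_affine_of_ge {Λ m b x : ℝ} (hm : 0 < m)
    (hx : log (gaussCDF x) ≤ Λ + m * x) (hmb : m ≤ b) :
    log (gaussCDF x) ≤ Λ + b * x + (|Λ| / m ^ 2 + 1) * (b ^ 2 - m ^ 2) := by
  have hb : 0 < b := hm.trans_le hmb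
  obtain ⟨η, hη⟩ : ∃ η, η * b = b - m := ⟨(b - m) / b, div_mul_cancel₀ _ hb.ne'⟩
  have hη0 : 0 ≤ η := nonneg_of_mul_nonneg_left (by linarith) hb
  have hη1 : η ≤ 1 := by nlinarith
  have hηm : η * m ≤ b - m := hη ▸ mul_le_mul_of_nonneg_left hmb hη0
  have hchernoff := log_gaussCDF_le_chernoff (add_pos hb hm).le x
  have hΛ : η * -Λ ≤ |Λ| / m ^ 2 * (b ^ 2 - m ^ 2) := by
    calc η * -Λ ≤ η * |Λ| := mul_le_mul_of_nonneg_left (neg_le_abs Λ) hη0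
      _ = |Λ| / m ^ 2 * (η * m ^ 2) := by field_simp
      _ ≤ |Λ| / m ^ 2 * (b ^ 2 - m ^ 2) := by gcongr; nlinarith
  calc log (gaussCDF x)
      = (1 - η) * log (gaussCDF x) + η * log (gaussCDF x) := by ring
    _ ≤ (1 - η) * (Λ + m * x) + η * ((b + m) * x + (b + m) ^ 2 / 2) := by gcongr
    _ = Λ + b * x + η * -Λ + η * (b + m) ^ 2 / 2 := by linear_combination x * hη
    _ ≤ Λ + b * x + (|Λ| / m ^ 2 + 1) * (b ^ 2 - m ^ 2) := by nlinarith [mul_nonneg hη0 hm.le]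

theorem exists_logCDFAffineBound (θ : ℝ) :
    ∃ K, 0 ≤ K ∧ LogCDFAffineBound (log (gaussCDF θ) - hazard θ * θ) (hazard θ) K := by
  set m := hazard θ
  set Λ := log (gaussCDF θ) - m * θ
  have hm : 0 < m := hazard_pos θ
  refine ⟨|Λ| / m ^ 2 + 1, by positivity, fun b hb x => ?_⟩
  have htangent : log (gaussCDF x) ≤ Λ + m * x := by
    linarith [log_gaussCDF_le_tangent θ x]
  rcases le_total b m with h | h
  · have hsq : b ^ 2 ≤ m ^ 2 := by gcongr
    rw [abs_sub_comm (b ^ 2), abs_of_nonneg (sub_nonneg.2 hsq)]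
    linarith [log_gaussCDF_le_affine_of_le hm htangent hb h]
  · have hsq : m ^ 2 ≤ b ^ 2 := by gcongr
    rw [abs_of_nonneg (sub_nonneg.2 hsq)]
    exact log_gaussCDF_le_affine_of_ge hm htangent h

theorem LogCDFAffineBound.intercept_nonneg {Λ m K : ℝ} (h : LogCDFAffineBound Λ m K) :
    0 ≤ Λ + K * m ^ 2 := by
  have hlim : Tendsto (fun x => log (gaussCDF x)) atTop (𝓝 0) := by
    have := (tendsto_cdf_atTop (gaussianReal 0 1)).log one_ne_zero
    rw [log_one] at this
    exact this.congr fun x => by rw [cdf_eq_real, gaussCDF]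
  refine le_of_tendsto' hlim fun x => ?_
  simpa using h 0 le_rfl x

-- For `r = 0` the half-line is empty or everything, and the bound is `Φ ≤ 1`.
theorem LogCDFAffineBound.measure_halfline_le {Λ m K : ℝ} (h : LogCDFAffineBound Λ m K)
    {κ r : ℝ} (hκ : 0 ≤ κ) (hr : 0 ≤ r) (v : ℝ) :
    gaussianReal 0 1 {z | r * z ≤ v}
      ≤ ENNReal.ofReal (exp (Λ + κ * v + K * |(κ * r) ^ 2 - m ^ 2|)) := by
  rcases hr.eq_or_lt with rfl | hr
  · rcases le_or_gt 0 v with hv | hv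
    · refine prob_le_one.trans ?_
      rw [ENNReal.one_le_ofReal, one_le_exp_iff]
      have := h.intercept_nonneg
      have hm : |(κ * 0) ^ 2 - m ^ 2| = m ^ 2 := by
        rw [mul_zero, zero_pow two_ne_zero, zero_sub, abs_neg, abs_of_nonneg (sq_nonneg m)]
      rw [hm]
      nlinarith
    · simp [not_le.2 hv]
  · have hset : {z | r * z ≤ v} = Iic (v / r) := by
      ext z
      rw [mem_ofPred_eq, mem_Iic, le_div_iff₀ hr, mul_comm]
    have hb := h (κ * r) (by positivity) (v / r)
    rw [log_le_iff_le_exp (gaussCDF_pos _), mul_assoc, mul_div_cancel₀ v hr.ne'] at hb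
    rw [hset, ← ofReal_measureReal]
    exact ENNReal.ofReal_le_ofReal hb

/-! ### Exponential integrals of Gaussian measures -/

theorem gaussianPDFReal_mul_exp {q : ℝ} (hq : 0 < q) (s z : ℝ) :
    gaussianPDFReal 0 1 z * exp (s * z + (1 - q ^ 2) / 2 * z ^ 2)
      = exp (s ^ 2 / (2 * q ^ 2) - log q)
        * gaussianPDFReal (s / q ^ 2) (q⁻¹ ^ 2).toNNReal z := by
  have hsqrt : √(2 * π * q⁻¹ ^ 2) = √(2 * π) * q⁻¹ := by
    rw [sqrt_mul (by positivity), sqrt_sq (by positivity)]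
  have hexponent : -z ^ 2 / 2 + (s * z + (1 - q ^ 2) / 2 * z ^ 2)
      = s ^ 2 / (2 * q ^ 2) + -(z - s / q ^ 2) ^ 2 / (2 * q⁻¹ ^ 2) := by
    field_simp
    ring
  simp only [gaussianPDFReal_def, NNReal.coe_one, mul_one, sub_zero,
    coe_toNNReal _ (sq_nonneg q⁻¹), hsqrt]
  rw [mul_assoc, ← exp_add, hexponent, exp_add, exp_sub, exp_log hq]
  field_simp

theorem gaussianReal_map_mul_add (t y : ℝ) :
    (gaussianReal 0 1).map (fun z => t * z + y) = gaussianReal y (t ^ 2).toNNReal := by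
  have hcomp : (fun z : ℝ => t * z + y) = (fun z => z + y) ∘ (fun z => t * z) := rfl
  rw [hcomp, ← Measure.map_map (by fun_prop) (by fun_prop), gaussianReal_map_const_mul,
    gaussianReal_map_add_const]
  congr 1
  · simp
  · ext
    simp [sq_nonneg]

theorem setLIntegral_exp_gaussianReal {q : ℝ} (hq : 0 < q) (s : ℝ) {S : Set ℝ}
    (hS : MeasurableSet S) :
    ∫⁻ z in S, ENNReal.ofReal (exp (s * z + (1 - q ^ 2) / 2 * z ^ 2)) ∂gaussianReal 0 1
      = ENNReal.ofReal (exp (s ^ 2 / (2 * q ^ 2) - log q))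
        * gaussianReal 0 1 {z | q⁻¹ * z + s / q ^ 2 ∈ S} := by
  have hvar : (q⁻¹ ^ 2).toNNReal ≠ 0 := by
    rw [Ne, toNNReal_eq_zero, not_le]
    positivity
  have hmap : gaussianReal 0 1 {z | q⁻¹ * z + s / q ^ 2 ∈ S}
      = gaussianReal (s / q ^ 2) (q⁻¹ ^ 2).toNNReal S := by
    rw [← gaussianReal_map_mul_add, Measure.map_apply (by fun_prop) hS]
    rfl
  rw [hmap, gaussianReal_apply _ hvar, gaussianReal_of_var_ne_zero _ one_ne_zero,
    setLIntegral_withDensity_eq_setLIntegral_mul _ (by fun_prop) (by fun_prop) hS,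
    ← lintegral_const_mul _ (by fun_prop)]
  congr 1 with z
  rw [Pi.mul_apply, gaussianPDF, gaussianPDF, ← ENNReal.ofReal_mul (gaussianPDFReal_nonneg _ _ _),
    ← ENNReal.ofReal_mul (by positivity), gaussianPDFReal_mul_exp hq]

theorem lintegral_exp_gaussianReal {q : ℝ} (hq : 0 < q) (s : ℝ) :
    ∫⁻ z, ENNReal.ofReal (exp (s * z + (1 - q ^ 2) / 2 * z ^ 2)) ∂gaussianReal 0 1
      = ENNReal.ofReal (exp (s ^ 2 / (2 * q ^ 2) - log q)) := by
  simpa using setLIntegral_exp_gaussianReal hq s MeasurableSet.univ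

theorem LogCDFAffineBound.setLIntegral_halfline_le {Λ m K : ℝ} (h : LogCDFAffineBound Λ m K)
    {κ q r : ℝ} (hκ : 0 ≤ κ) (hq : 0 < q) (hr : 0 ≤ r) (s a : ℝ) :
    ∫⁻ z in {z | r * z ≤ a}, ENNReal.ofReal (exp (s * z + (1 - q ^ 2) / 2 * z ^ 2))
        ∂gaussianReal 0 1
      ≤ ENNReal.ofReal (exp (s ^ 2 / (2 * q ^ 2) - log q + (Λ + κ * (a - r * s / q ^ 2)
        + K * |(κ * (r / q)) ^ 2 - m ^ 2|))) := by
  have hset : {z | q⁻¹ * z + s / q ^ 2 ∈ {z | r * z ≤ a}}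
      = {z | r / q * z ≤ a - r * s / q ^ 2} := by
    ext z
    rw [mem_ofPred_eq, mem_ofPred_eq, mem_ofPred_eq, le_sub_iff_add_le]
    ring_nf
  rw [setLIntegral_exp_gaussianReal hq s (measurableSet_le (by fun_prop) (by fun_prop)), hset,
    exp_add, ENNReal.ofReal_mul (exp_pos _).le]
  gcongr
  exact h.measure_halfline_le hκ (div_nonneg hr hq.le) (a - r * s / q ^ 2)

theorem ofReal_exp_add (x y : ℝ) :
    ENNReal.ofReal (exp (x + y)) = ENNReal.ofReal (exp x) * ENNReal.ofReal (exp y) := by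
  rw [exp_add, ENNReal.ofReal_mul (exp_pos x).le]

theorem ofReal_exp_sum {ι : Type*} (s : Finset ι) (f : ι → ℝ) :
    ENNReal.ofReal (exp (∑ i ∈ s, f i)) = ∏ i ∈ s, ENNReal.ofReal (exp (f i)) := by
  rw [exp_sum, ENNReal.ofReal_prod_of_nonneg fun i _ => (exp_pos _).le]

theorem lintegral_pi_fin_prod {n : ℕ} {α : Fin n → Type*} [∀ i, MeasurableSpace (α i)]
    (μ : ∀ i, Measure (α i)) [∀ i, SigmaFinite (μ i)] {f : ∀ i, α i → ℝ≥0∞}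
    (hf : ∀ i, Measurable (f i)) :
    ∫⁻ z, ∏ i, f i (z i) ∂Measure.pi μ = ∏ i, ∫⁻ z, f i z ∂μ i := by
  induction n with
  | zero => simp
  | succ n ih =>
    have hmeas : Measurable fun z : ∀ i, α i => ∏ i, f i (z i) :=
      Finset.measurable_prod _ fun i _ => (hf i).comp (measurable_pi_apply i)
    rw [← (measurePreserving_piFinSuccAbove μ 0).symm.lintegral_comp hmeas]
    simp only [Fin.prod_univ_succ]
    rw [← ih (fun i => μ i.succ) fun i => hf i.succ, ← lintegral_prod_mul (hf 0).aemeasurable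
      (Finset.measurable_prod _ fun i _ => (hf i.succ).comp (measurable_pi_apply i)).aemeasurable]
    rfl

theorem lintegral_pi_prod {ι : Type*} [Fintype ι] {α : ι → Type*} [∀ i, MeasurableSpace (α i)]
    (μ : ∀ i, Measure (α i)) [∀ i, SigmaFinite (μ i)] {f : ∀ i, α i → ℝ≥0∞}
    (hf : ∀ i, Measurable (f i)) :
    ∫⁻ z, ∏ i, f i (z i) ∂Measure.pi μ = ∏ i, ∫⁻ z, f i z ∂μ i := by
  let e := (Fintype.equivFin ι).symm
  have hmeas : Measurable fun z : ∀ i, α i => ∏ i, f i (z i) :=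
    Finset.measurable_prod _ fun i _ => (hf i).comp (measurable_pi_apply i)
  rw [← (measurePreserving_piCongrLeft μ e).lintegral_comp hmeas]
  simp_rw [← e.prod_comp, MeasurableEquiv.coe_piCongrLeft, Equiv.piCongrLeft_apply_apply]
  exact lintegral_pi_fin_prod (fun i => μ (e i)) fun i => hf (e i)

theorem setLIntegral_pi_prod {ι : Type*} [Fintype ι] {α : ι → Type*} [∀ i, MeasurableSpace (α i)]
    (μ : ∀ i, Measure (α i)) [∀ i, SigmaFinite (μ i)] (S : ∀ i, Set (α i))
    {f : ∀ i, α i → ℝ≥0∞} (hf : ∀ i, Measurable (f i)) :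
    ∫⁻ z in univ.pi S, ∏ i, f i (z i) ∂Measure.pi μ = ∏ i, ∫⁻ z in S i, f i z ∂μ i := by
  rw [Measure.restrict_pi_pi, lintegral_pi_prod _ hf]

theorem neg_log_le_of_sq_eq_one_sub {q x : ℝ} (hx : x ≤ 1 / 2) (h : q ^ 2 = 1 - x) :
    -log q ≤ x / 2 + x ^ 2 := by
  have hinv : (1 - x)⁻¹ ≤ 1 + x + 2 * x ^ 2 := by
    rw [inv_le_iff_one_le_mul₀ (by linarith)]
    nlinarith [sq_nonneg x]
  have hlog := one_sub_inv_le_log_of_pos (show 0 < 1 - x by linarith)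
  rw [← h, log_pow, h, Nat.cast_two] at hlog
  linarith

section NormMoments

variable {E : Type*} [NormedAddCommGroup E] [InnerProductSpace ℝ E] [FiniteDimensional ℝ E]
  [MeasurableSpace E] [BorelSpace E]

theorem lintegral_exp_sq_norm_stdGaussian {q : ℝ} (hq : 0 < q) :
    ∫⁻ x, ENNReal.ofReal (exp ((1 - q ^ 2) / 2 * ‖x‖ ^ 2)) ∂stdGaussian E
      = ENNReal.ofReal (exp (Module.finrank ℝ E * -log q)) := by
  have hexp : ∀ z : Fin (Module.finrank ℝ E) → ℝ,
      ENNReal.ofReal (exp ((1 - q ^ 2) / 2 * ‖∑ i, z i • stdOrthonormalBasis ℝ E i‖ ^ 2))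
        = ∏ i, ENNReal.ofReal (exp (0 * z i + (1 - q ^ 2) / 2 * z i ^ 2)) := by
    intro z
    rw [← ofReal_exp_sum, ← (stdOrthonormalBasis ℝ E).repr.norm_map, EuclideanSpace.real_norm_sq_eq,
      Finset.mul_sum]
    simp [Pi.single_apply]
  rw [stdGaussian, lintegral_map (by fun_prop) (by fun_prop), lintegral_congr hexp,
    lintegral_pi_prod (f := fun _ z => ENNReal.ofReal (exp (0 * z + (1 - q ^ 2) / 2 * z ^ 2))) _
      fun _ => by fun_prop]
  simp only [lintegral_exp_gaussianReal hq, ← ofReal_exp_sum]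
  simp

theorem lintegral_exp_mul_sq_norm_sub_le {N k t : ℝ} (hN : Module.finrank ℝ E ≤ N)
    (hNk : N ≤ Module.finrank ℝ E + k) (ht : |t| ≤ 1 / 4) :
    ∫⁻ x, ENNReal.ofReal (exp (t * (‖x‖ ^ 2 - N))) ∂stdGaussian E
      ≤ ENNReal.ofReal (exp (|t| * k + 4 * t ^ 2 * N)) := by
  obtain ⟨-, ht'⟩ := abs_le.1 ht
  set d : ℝ := (Module.finrank ℝ E : ℝ)
  obtain ⟨q, hq, hq2⟩ : ∃ q : ℝ, 0 < q ∧ q ^ 2 = 1 - 2 * t :=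
    ⟨√(1 - 2 * t), sqrt_pos.2 (by linarith), sq_sqrt (by linarith)⟩
  have hsplit : ∀ x : E, ENNReal.ofReal (exp (t * (‖x‖ ^ 2 - N)))
      = ENNReal.ofReal (exp ((1 - q ^ 2) / 2 * ‖x‖ ^ 2)) * ENNReal.ofReal (exp (-(t * N))) := by
    intro x
    rw [← ofReal_exp_add, hq2]
    ring_nf
  have hexponent : d * -log q + -(t * N) ≤ |t| * k + 4 * t ^ 2 * N := by
    have h0 : d * -log q ≤ d * (2 * t / 2 + (2 * t) ^ 2) := by
      gcongr
      exact neg_log_le_of_sq_eq_one_sub (by linarith) hq2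
    have h1 : -t * (N - d) ≤ |t| * (N - d) :=
      mul_le_mul_of_nonneg_right (neg_le_abs t) (by linarith)
    have h2 : |t| * (N - d) ≤ |t| * k := mul_le_mul_of_nonneg_left (by linarith) (abs_nonneg t)
    have h3 : t ^ 2 * d ≤ t ^ 2 * N := mul_le_mul_of_nonneg_left hN (sq_nonneg t)
    linarith
  rw [lintegral_congr hsplit, lintegral_mul_const _ (by fun_prop),
    lintegral_exp_sq_norm_stdGaussian hq, ← ofReal_exp_add]
  gcongr

theorem lintegral_exp_mul_abs_sq_norm_sub_le {N k t : ℝ} (hN : Module.finrank ℝ E ≤ N)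
    (hNk : N ≤ Module.finrank ℝ E + k) (ht₀ : 0 ≤ t) (ht : t ≤ 1 / 4) :
    ∫⁻ x, ENNReal.ofReal (exp (t * |‖x‖ ^ 2 - N|)) ∂stdGaussian E
      ≤ ENNReal.ofReal (exp (1 + (t * k + 4 * t ^ 2 * N))) := by
  have habs : |t| = t := abs_of_nonneg ht₀
  have hle : ∀ x : E, ENNReal.ofReal (exp (t * |‖x‖ ^ 2 - N|))
      ≤ ENNReal.ofReal (exp (t * (‖x‖ ^ 2 - N))) + ENNReal.ofReal (exp (-t * (‖x‖ ^ 2 - N))) := by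
    intro x
    rw [← ENNReal.ofReal_add (exp_pos _).le (exp_pos _).le, ← habs, ← abs_mul, habs, neg_mul]
    exact ENNReal.ofReal_le_ofReal (exp_abs_le _)
  have hpos := lintegral_exp_mul_sq_norm_sub_le hN hNk (t := t) (by rwa [habs])
  have hneg := lintegral_exp_mul_sq_norm_sub_le hN hNk (t := -t) (by rwa [abs_neg, habs])
  rw [abs_neg, neg_sq, habs] at hneg
  rw [habs] at hpos
  have htwo : 2 ≤ exp 1 := by linarith [add_one_le_exp (1 : ℝ)]
  calc ∫⁻ x, ENNReal.ofReal (exp (t * |‖x‖ ^ 2 - N|)) ∂stdGaussian E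
      ≤ ∫⁻ x, (ENNReal.ofReal (exp (t * (‖x‖ ^ 2 - N)))
          + ENNReal.ofReal (exp (-t * (‖x‖ ^ 2 - N)))) ∂stdGaussian E := lintegral_mono hle
    _ ≤ 2 * ENNReal.ofReal (exp (t * k + 4 * t ^ 2 * N)) := by
        rw [lintegral_add_left (by fun_prop), two_mul]
        exact add_le_add hpos hneg
    _ ≤ ENNReal.ofReal (exp (1 + (t * k + 4 * t ^ 2 * N))) := by
        rw [ofReal_exp_add 1]
        gcongr
        rwa [← ENNReal.ofReal_ofNat, ENNReal.ofReal_le_ofReal_iff (exp_pos 1).le]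

theorem lintegral_exp_abs_sq_norm_sub_le {N k n κ m K : ℝ} (hN : Module.finrank ℝ E ≤ N)
    (hNk : N ≤ Module.finrank ℝ E + k) (hκ : 0 ≤ κ) (hm : κ ^ 2 * N = m ^ 2) (hK : 0 ≤ K)
    (hKκ : K * κ ≤ 1 / 2) (hn : 0 ≤ n) (hnk : n ≤ k) (hkκ : k * κ ≤ 1 / 2) :
    ∫⁻ x, ENNReal.ofReal (exp (n * (K * |(κ * ‖x‖) ^ 2 - m ^ 2|))) ∂stdGaussian E
      ≤ ENNReal.ofReal (exp (1 + K / 4 + K ^ 2 * m ^ 2)) := by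
  have hk : 0 ≤ k := hn.trans hnk
  have hnκ : n * κ ≤ 1 / 2 := (mul_le_mul_of_nonneg_right hnk hκ).trans hkκ
  set t := n * κ * (K * κ) with ht
  have ht4 : t ≤ 1 / 4 := by
    calc t ≤ 1 / 2 * (1 / 2) := by rw [ht]; gcongr
      _ = 1 / 4 := by norm_num
  have hscale : ∀ x : E, n * (K * |(κ * ‖x‖) ^ 2 - m ^ 2|) = t * |‖x‖ ^ 2 - N| := by
    intro x
    rw [← hm, mul_pow, ← mul_sub, abs_mul, abs_of_nonneg (sq_nonneg κ), ht]
    ring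
  have hlinear : t * k ≤ K / 4 := by
    calc t * k = K * ((n * κ) * (k * κ)) := by rw [ht]; ring
      _ ≤ K * (1 / 2 * (1 / 2)) := by gcongr
      _ = K / 4 := by ring
  have hquadratic : 4 * t ^ 2 * N ≤ K ^ 2 * m ^ 2 := by
    calc 4 * t ^ 2 * N = 4 * (n * κ) ^ 2 * (K ^ 2 * m ^ 2) := by rw [← hm, ht]; ring
      _ ≤ 4 * (1 / 2) ^ 2 * (K ^ 2 * m ^ 2) := by gcongr
      _ = K ^ 2 * m ^ 2 := by ring
  simp only [hscale]
  exact (lintegral_exp_mul_abs_sq_norm_sub_le hN hNk (by positivity) ht4).trans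
    (ENNReal.ofReal_le_ofReal (exp_le_exp.2 (by linarith)))

end NormMoments

/-! ### Exposing one vector -/

/-- The sum of `B i j` over the pairs `i < j`. -/
def pairSum {n : ℕ} (B : Fin n → Fin n → ℝ) : ℝ := ∑ i, ∑ j ∈ Finset.Ioi i, B i j

theorem pairSum_succ {n : ℕ} (B : Fin (n + 1) → Fin (n + 1) → ℝ) :
    pairSum B = ∑ j : Fin n, B 0 j.succ + pairSum fun i j => B i.succ j.succ := by
  simp [pairSum, Fin.sum_univ_succ]

theorem pairSum_sub_mul {n : ℕ} (A B : Fin n → Fin n → ℝ) (c : ℝ) :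
    pairSum (fun i j => A i j - c * B i j) = pairSum A - c * pairSum B := by
  simp only [pairSum, Finset.sum_sub_distrib, Finset.mul_sum]

theorem pairSum_const {n : ℕ} (c : ℝ) : pairSum (fun _ _ : Fin n => c) = n.choose 2 * c := by
  induction n with
  | zero => simp [pairSum]
  | succ n ih =>
    rw [pairSum_succ, ih, Nat.choose_succ_succ' n 1]
    simp
    ring

theorem pairSum_mul {n : ℕ} (z : Fin n → ℝ) :
    pairSum (fun i j => z i * z j) = ((∑ i, z i) ^ 2 - ∑ i, z i ^ 2) / 2 := by
  induction n with
  | zero => simp [pairSum]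
  | succ n ih =>
    rw [pairSum_succ, ih fun i => z i.succ, Fin.sum_univ_succ, Fin.sum_univ_succ, ← Finset.mul_sum]
    ring

theorem LogCDFAffineBound.setLIntegral_pi_halfline_le {Λ m K : ℝ}
    (h : LogCDFAffineBound Λ m K) {κ q r : ℝ} (hκ : 0 ≤ κ) (hq : 0 < q) (hr : 0 ≤ r) (s : ℝ)
    {n : ℕ} (a : Fin n → ℝ) :
    ∫⁻ z in {z : Fin n → ℝ | ∀ j, r * z j ≤ a j},
        ENNReal.ofReal (exp (∑ j, (s * z j + (1 - q ^ 2) / 2 * z j ^ 2)))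
        ∂Measure.pi (fun _ => gaussianReal 0 1)
      ≤ ENNReal.ofReal (exp (κ * ∑ j, a j + n * (s ^ 2 / (2 * q ^ 2) - log q + Λ
        - κ * r * s / q ^ 2 + K * |(κ * r / q) ^ 2 - m ^ 2|))) := by
  have hset : {z : Fin n → ℝ | ∀ j, r * z j ≤ a j} = univ.pi fun j => {z | r * z ≤ a j} := by
    ext z
    simp
  simp only [ofReal_exp_sum]
  rw [hset, setLIntegral_pi_prod
    (f := fun _ z => ENNReal.ofReal (exp (s * z + (1 - q ^ 2) / 2 * z ^ 2)))
    (fun _ => gaussianReal 0 1) (fun j => {z | r * z ≤ a j}) fun _ => by fun_prop]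
  refine (Finset.prod_le_prod' fun j _ => h.setLIntegral_halfline_le hκ hq hr s (a j)).trans ?_
  rw [← ofReal_exp_sum, Finset.mul_sum]
  refine ENNReal.ofReal_le_ofReal (exp_le_exp.2 (le_of_eq ?_))
  simp only [Finset.sum_add_distrib, Finset.sum_const, Finset.card_univ, Fintype.card_fin,
    nsmul_eq_mul, mul_sub, Finset.sum_sub_distrib]
  ring_nf

/-- The exponent of the bound for the probability that, given a new vector, each of the `n`
remaining ones satisfies the constraint it imposes, in terms of an affine bound for `log Φ` with
intercept `Λ` and preferred slope `m`. The sign `σ` is `1` for upper and `-1` for lower bounds on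
the inner products, and `κ` is the slope in the unnormalised inner products. -/
noncomputable def sliceExponent (σ κ Λ m : ℝ) (n : ℕ) : ℝ :=
  n * Λ - σ * κ * m ^ 2 * n ^ 2 / 2 + κ ^ 2 * m ^ 2 * n ^ 3

section Slice

variable {Λ m K κ r : ℝ} {n : ℕ}

-- Completing the square in `∑ z`, recentred at its typical value `-m n`.
theorem neg_pairSum_mul_le (hκ : 0 ≤ κ) (m : ℝ) (z : Fin n → ℝ) :
    -κ * pairSum (fun i j => z i * z j)
      ≤ κ * (m * n) ^ 2 / 2 + ∑ j, (κ * m * n * z j + κ / 2 * z j ^ 2) := by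
  rw [pairSum_mul, Finset.sum_add_distrib, ← Finset.mul_sum, ← Finset.mul_sum]
  linarith [mul_nonneg hκ (sq_nonneg (∑ j, z j + m * n))]

theorem red_sliceExponent_le {u y : ℝ} (hm : 0 < m) (hK : 0 ≤ K) (hκ : 0 ≤ κ) (hκ2 : κ ≤ 1 / 2)
    (hnκ : n * κ ≤ 1 / 2) (hy : 0 ≤ y) (hu : 1 ≤ u) (huκ : u ≤ 1 + 2 * κ) :
    κ * (m * n) ^ 2 / 2 + n * ((κ * m * n) ^ 2 * u / 2 + (κ / 2 + κ ^ 2) + Λ - y * (κ * m * n) * u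
        + K * |y ^ 2 * u - m ^ 2|)
      ≤ sliceExponent 1 κ Λ m n + (1 / 2 + K * m ^ 2)
        + n * ((2 * K + 1) * |y ^ 2 - m ^ 2|) := by
  set δ := |y ^ 2 - m ^ 2| with hδ
  have : 0 ≤ δ := abs_nonneg _
  have : (0 : ℝ) ≤ n := n.cast_nonneg
  have hsquare : n * ((κ * m * n) ^ 2 * u / 2) ≤ κ ^ 2 * m ^ 2 * n ^ 3 := by
    calc n * ((κ * m * n) ^ 2 * u / 2) ≤ n * ((κ * m * n) ^ 2 * 2 / 2) := by gcongr; linarith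
      _ = κ ^ 2 * m ^ 2 * n ^ 3 := by ring
  have hcross : n * (κ * n) * (m ^ 2 - δ) ≤ n * (y * (κ * m * n) * u) := by
    have hmy : m ^ 2 - δ ≤ m * y := by
      have : δ = |y - m| * (y + m) := by
        rw [hδ, ← abs_of_nonneg (add_nonneg hy hm.le), ← abs_mul]
        ring_nf
      nlinarith [neg_le_abs (y - m), abs_nonneg (y - m)]
    calc n * (κ * n) * (m ^ 2 - δ) ≤ n * (κ * n) * (m * y) := by gcongr
      _ = n * (y * (κ * m * n) * 1) := by ring
      _ ≤ n * (y * (κ * m * n) * u) := by gcongr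
  have habs : |y ^ 2 * u - m ^ 2| ≤ 2 * δ + 2 * κ * m ^ 2 := by
    calc |y ^ 2 * u - m ^ 2| = |u * (y ^ 2 - m ^ 2) + (u - 1) * m ^ 2| := by ring_nf
      _ ≤ u * δ + (u - 1) * m ^ 2 := by
          refine (abs_add_le _ _).trans_eq ?_
          rw [abs_mul, abs_of_nonneg (zero_le_one.trans hu),
            abs_of_nonneg (mul_nonneg (sub_nonneg.2 hu) (sq_nonneg m))]
      _ ≤ 2 * δ + 2 * κ * m ^ 2 := by gcongr <;> linarith
  have hvariance : n * (K * |y ^ 2 * u - m ^ 2|) ≤ n * (K * (2 * δ + 2 * κ * m ^ 2)) := by gcongr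
  have hκκ : n * κ * κ ≤ 1 / 2 * (1 / 2) := by gcongr
  have hKm : n * κ * (2 * K * m ^ 2) ≤ 1 / 2 * (2 * K * m ^ 2) := by gcongr
  have hnδ : n * κ * (n * δ) ≤ 1 / 2 * (n * δ) := by gcongr
  have hnδ0 : 0 ≤ n * δ := by positivity
  rw [sliceExponent]
  linarith

theorem LogCDFAffineBound.red_slice_le (h : LogCDFAffineBound Λ m K) (hm : 0 < m) (hK : 0 ≤ K)
    (hκ : 0 ≤ κ) (hκ2 : κ ≤ 1 / 2) (hnκ : n * κ ≤ 1 / 2) (hr : 0 ≤ r) (a : Fin n → ℝ) :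
    ∫⁻ z in {z : Fin n → ℝ | ∀ j, r * z j ≤ a j},
        ENNReal.ofReal (exp (-(1 * κ) * pairSum fun i j => z i * z j))
        ∂Measure.pi (fun _ => gaussianReal 0 1)
      ≤ ENNReal.ofReal (exp (κ * ∑ j, a j + (sliceExponent 1 κ Λ m n + (1 / 2 + K * m ^ 2)
        + n * ((2 * K + 1) * |(κ * r) ^ 2 - m ^ 2|)))) := by
  obtain ⟨q, hq, hq2⟩ : ∃ q : ℝ, 0 < q ∧ q ^ 2 = 1 - κ :=
    ⟨√(1 - κ), sqrt_pos.2 (by linarith), sq_sqrt (by linarith)⟩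
  have hlog := neg_log_le_of_sq_eq_one_sub hκ2 hq2
  have hpointwise : ∀ z : Fin n → ℝ,
      ENNReal.ofReal (exp (-(1 * κ) * pairSum fun i j => z i * z j))
        ≤ ENNReal.ofReal (exp (κ * (m * n) ^ 2 / 2)) * ENNReal.ofReal
          (exp (∑ j, (κ * m * n * z j + (1 - q ^ 2) / 2 * z j ^ 2))) := by
    intro z
    rw [← ofReal_exp_add, one_mul, hq2, sub_sub_cancel]
    exact ENNReal.ofReal_le_ofReal (exp_le_exp.2 (neg_pairSum_mul_le hκ m z))
  have hu : 1 ≤ (q ^ 2)⁻¹ := (one_le_inv₀ (by positivity)).2 (by linarith)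
  have huκ : (q ^ 2)⁻¹ ≤ 1 + 2 * κ := by
    rw [hq2, inv_le_iff_one_le_mul₀ (by linarith)]
    nlinarith
  refine (lintegral_mono hpointwise).trans ?_
  rw [lintegral_const_mul _ (by fun_prop)]
  refine (mul_le_mul_right (h.setLIntegral_pi_halfline_le hκ hq hr _ a) _).trans ?_
  rw [← ofReal_exp_add]
  refine ENNReal.ofReal_le_ofReal (exp_le_exp.2 ?_)
  have hexponent := red_sliceExponent_le (Λ := Λ) hm hK hκ hκ2 hnκ (mul_nonneg hκ hr) hu huκ
  have hn : n * -log q ≤ n * (κ / 2 + κ ^ 2) := by gcongr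
  have hdiv : ∀ x c : ℝ, x / (c * q ^ 2) = x * (q ^ 2)⁻¹ / c := fun x c => by field_simp
  rw [hdiv, div_pow, div_eq_mul_inv _ (q ^ 2), div_eq_mul_inv _ (q ^ 2)]
  linarith

theorem blue_sliceExponent_le {y : ℝ} (hκ : 0 ≤ κ) (hK : 0 ≤ K) (hnκ : n * κ ≤ 1 / 2) :
    n * (Λ + K * |y ^ 2 - m ^ 2|) + ((n * y) ^ 2 * κ / (2 * (1 - n * κ))
        + (n * κ / 2 + (n * κ) ^ 2))
      ≤ sliceExponent (-1) κ Λ m n + (1 / 2 + K * m ^ 2)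
        + n * ((2 * K + 1) * |y ^ 2 - m ^ 2|) := by
  set δ := |y ^ 2 - m ^ 2|
  have hδ : 0 ≤ δ := abs_nonneg _
  have hyδ : y ^ 2 ≤ m ^ 2 + δ := sub_le_iff_le_add'.1 (le_abs_self _)
  have hnκ0 : 0 ≤ n * κ := by positivity
  have hsq : (n * κ) ^ 2 ≤ (1 / 2) ^ 2 := by gcongr
  have hnκ1 : 0 < 1 - n * κ := by linarith
  have hmain : (n * y) ^ 2 * κ / (2 * (1 - n * κ)) ≤ n ^ 2 * κ * (m ^ 2 + δ) * (1 / 2 + n * κ) := by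
    have hinv : 1 / (2 * (1 - n * κ)) ≤ 1 / 2 + n * κ := by
      rw [div_le_iff₀ (by linarith)]
      nlinarith
    calc (n * y) ^ 2 * κ / (2 * (1 - n * κ))
        = n ^ 2 * κ * y ^ 2 * (1 / (2 * (1 - n * κ))) := by ring
      _ ≤ n ^ 2 * κ * (m ^ 2 + δ) * (1 / 2 + n * κ) := by gcongr
  have hnδ : n * κ * (1 / 2 + n * κ) * (n * δ) ≤ 1 / 2 * (1 / 2 + 1 / 2) * (n * δ) := by gcongr
  have hKδ : 0 ≤ n * (K * δ) := by positivity
  have hKm : 0 ≤ K * m ^ 2 := by positivity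
  rw [sliceExponent]
  nlinarith

-- `exp (κ t² / 2) = E exp (√κ t g)` for a standard Gaussian `g` decouples the coordinates.
theorem exp_pairSum_mul_le_lintegral (hκ : 0 ≤ κ) (z : Fin n → ℝ) :
    ENNReal.ofReal (exp (κ * pairSum fun i j => z i * z j))
      ≤ ∫⁻ g, ENNReal.ofReal (exp (∑ j, (√κ * g * z j + (1 - 1 ^ 2) / 2 * z j ^ 2)))
        ∂gaussianReal 0 1 := by
  have hlinear : ∀ g : ℝ, ∑ j, (√κ * g * z j + (1 - 1 ^ 2) / 2 * z j ^ 2)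
      = √κ * (∑ j, z j) * g + (1 - 1 ^ 2) / 2 * g ^ 2 := by
    intro g
    rw [Finset.sum_add_distrib, ← Finset.mul_sum, ← Finset.mul_sum]
    ring
  simp only [hlinear]
  rw [lintegral_exp_gaussianReal one_pos, pairSum_mul, mul_pow, sq_sqrt hκ, log_one]
  refine ENNReal.ofReal_le_ofReal (exp_le_exp.2 ?_)
  have : 0 ≤ κ * ∑ i, z i ^ 2 := mul_nonneg hκ (Finset.sum_nonneg fun i _ => sq_nonneg _)
  linarith

theorem LogCDFAffineBound.blue_slice_le (h : LogCDFAffineBound Λ m K) (hK : 0 ≤ K)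
    (hκ : 0 ≤ κ) (hnκ : n * κ ≤ 1 / 2) (hr : 0 ≤ r) (a : Fin n → ℝ) :
    ∫⁻ z in {z : Fin n → ℝ | ∀ j, r * z j ≤ a j},
        ENNReal.ofReal (exp (-(-1 * κ) * pairSum fun i j => z i * z j))
        ∂Measure.pi (fun _ => gaussianReal 0 1)
      ≤ ENNReal.ofReal (exp (κ * ∑ j, a j + (sliceExponent (-1) κ Λ m n + (1 / 2 + K * m ^ 2)
        + n * ((2 * K + 1) * |(κ * r) ^ 2 - m ^ 2|)))) := by
  obtain ⟨q, hq, hq2⟩ : ∃ q : ℝ, 0 < q ∧ q ^ 2 = 1 - n * κ :=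
    ⟨√(1 - n * κ), sqrt_pos.2 (by linarith), sq_sqrt (by linarith)⟩
  have hlog := neg_log_le_of_sq_eq_one_sub hnκ hq2
  set c := κ * ∑ j, a j + n * (Λ + K * |(κ * r) ^ 2 - m ^ 2|) with hc
  have hfixed : ∀ g : ℝ, ∫⁻ z in {z : Fin n → ℝ | ∀ j, r * z j ≤ a j},
        ENNReal.ofReal (exp (∑ j, (√κ * g * z j + (1 - 1 ^ 2) / 2 * z j ^ 2)))
        ∂Measure.pi (fun _ => gaussianReal 0 1)
      ≤ ENNReal.ofReal (exp c) * ENNReal.ofReal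
        (exp (-(n * (κ * r) * √κ) * g + (1 - q ^ 2) / 2 * g ^ 2)) := by
    intro g
    refine (h.setLIntegral_pi_halfline_le hκ one_pos hr (√κ * g) a).trans ?_
    rw [← ofReal_exp_add, log_one, mul_pow, sq_sqrt hκ, hq2, div_one]
    exact ENNReal.ofReal_le_ofReal (exp_le_exp.2 (le_of_eq (by rw [hc]; ring)))
  rw [neg_one_mul, neg_neg]
  refine (lintegral_mono (exp_pairSum_mul_le_lintegral hκ)).trans ?_
  rw [lintegral_lintegral_swap (Measurable.aemeasurable (by fun_prop))]
  refine (lintegral_mono hfixed).trans ?_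
  rw [lintegral_const_mul _ (by fun_prop), lintegral_exp_gaussianReal hq, ← ofReal_exp_add, neg_sq,
    mul_pow _ √κ, sq_sqrt hκ]
  refine ENNReal.ofReal_le_ofReal (exp_le_exp.2 ?_)
  rw [hq2]
  linarith [blue_sliceExponent_le (Λ := Λ) (m := m) (y := κ * r) hκ hK hnκ]

end Slice

/-- The effect of exposing one Gaussian vector `x ∈ ℝ^d` together with the components `z` of `n`
further vectors along it, constrained by `‖x‖ * z j ≤ a j`. The weight is what a bound
`exp (κ * pairSum A)` for the remaining constraints gains when each `A i j` is replaced by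
`A i j - σ * (z i * z j)`. -/
def LayerBound (σ κ : ℝ) (n d : ℕ) (β : ℝ) : Prop :=
  ∀ a : Fin n → ℝ,
    ∫⁻ x, ∫⁻ z in {z : Fin n → ℝ | ∀ j, ‖x‖ * z j ≤ a j},
        ENNReal.ofReal (exp (-(σ * κ) * pairSum fun i j => z i * z j))
          ∂Measure.pi (fun _ => gaussianReal 0 1) ∂stdGaussian (EuclideanSpace ℝ (Fin d))
      ≤ ENNReal.ofReal (exp (κ * ∑ j, a j + β))

theorem exists_layerBound (θ : ℝ) : ∃ B κ₀ : ℝ, 0 < κ₀ ∧ ∀ σ κ : ℝ, ∀ n k d d₀ : ℕ, |σ| = 1 →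
    0 ≤ κ → κ ≤ κ₀ → κ ^ 2 * d₀ = hazard θ ^ 2 → k * κ ≤ 1 / 2 → n ≤ k → d ≤ d₀ → d₀ ≤ d + k →
    LayerBound σ κ n d
      (sliceExponent σ κ (log (gaussCDF θ) - hazard θ * θ) (hazard θ) n + B) := by
  obtain ⟨K, hK, hbound⟩ := exists_logCDFAffineBound θ
  set m := hazard θ
  set Λ := log (gaussCDF θ) - m * θ
  refine ⟨(1 / 2 + K * m ^ 2) + (1 + (2 * K + 1) / 4 + (2 * K + 1) ^ 2 * m ^ 2),
    1 / (2 * (2 * K + 1)), by positivity, ?_⟩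
  intro σ κ n k d d₀ hσ hκ hκ₀ hm hkκ hnk hd hdk a
  have hKκ : (2 * K + 1) * κ ≤ 1 / 2 := by
    rw [le_div_iff₀ (by positivity)] at hκ₀
    linarith
  have hκ2 : κ ≤ 1 / 2 := (le_mul_of_one_le_left hκ (by linarith)).trans hKκ
  have hnκ : n * κ ≤ 1 / 2 := le_trans (by gcongr) hkκ
  have hslice : ∀ r : ℝ, 0 ≤ r → ∫⁻ z in {z : Fin n → ℝ | ∀ j, r * z j ≤ a j},
        ENNReal.ofReal (exp (-(σ * κ) * pairSum fun i j => z i * z j))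
        ∂Measure.pi (fun _ => gaussianReal 0 1)
      ≤ ENNReal.ofReal (exp (κ * ∑ j, a j + (sliceExponent σ κ Λ m n + (1 / 2 + K * m ^ 2)
        + n * ((2 * K + 1) * |(κ * r) ^ 2 - m ^ 2|)))) := by
    intro r hr
    rcases eq_or_eq_neg_of_abs_eq hσ with rfl | rfl
    · exact hbound.red_slice_le (hazard_pos θ) hK hκ hκ2 hnκ hr a
    · exact hbound.blue_slice_le hK hκ hnκ hr a
  refine (lintegral_mono fun x => hslice ‖x‖ (norm_nonneg x)).trans ?_
  simp only [← add_assoc, ofReal_exp_add _ (n * _)]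
  rw [lintegral_const_mul _ (by fun_prop)]
  grw [lintegral_exp_abs_sq_norm_sub_le (N := d₀) (k := k) (by simpa using hd)
    (by simpa using mod_cast hdk) hκ hm (by positivity) hKκ n.cast_nonneg (mod_cast hnk) hkκ]
  rw [← ofReal_exp_add]
  exact ENNReal.ofReal_le_ofReal (exp_le_exp.2 (by linarith))

/-! ### Exposing all vectors -/

/-- The configurations with `σ * ⟪x i, x j⟫ ≤ A i j` for all `i < j`. -/
def pairEvent (σ : ℝ) {n : ℕ} (d : ℕ) (A : Fin n → Fin n → ℝ) :
    Set (Fin n → EuclideanSpace ℝ (Fin d)) :=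
  {x | ∀ i j, i < j → σ * inner ℝ (x i) (x j) ≤ A i j}

theorem measurableSet_pairEvent (σ : ℝ) {n : ℕ} (d : ℕ) (A : Fin n → Fin n → ℝ) :
    MeasurableSet (pairEvent σ d A) := by
  unfold pairEvent
  measurability

theorem cons_mem_pairEvent {σ : ℝ} {n d : ℕ} {A : Fin (n + 1) → Fin (n + 1) → ℝ}
    {x : EuclideanSpace ℝ (Fin d)} {y : Fin n → EuclideanSpace ℝ (Fin d)} :
    (Fin.cons x y : Fin (n + 1) → EuclideanSpace ℝ (Fin d)) ∈ pairEvent σ d A ↔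
      (∀ j, σ * inner ℝ x (y j) ≤ A 0 j.succ) ∧
        y ∈ pairEvent σ d fun i j => A i.succ j.succ := by
  simp [pairEvent, Fin.forall_fin_succ (n := n)]

/-- The vector with first coordinate `t` and remaining coordinates `w`. -/
noncomputable def consVec {d : ℕ} (t : ℝ) (w : EuclideanSpace ℝ (Fin d)) :
    EuclideanSpace ℝ (Fin (d + 1)) :=
  WithLp.toLp 2 (Fin.cons t w.ofLp : Fin (d + 1) → ℝ)

theorem inner_consVec {d : ℕ} (t t' : ℝ) (w w' : EuclideanSpace ℝ (Fin d)) :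
    inner ℝ (consVec t w) (consVec t' w') = t * t' + inner ℝ w w' := by
  simp [consVec, PiLp.inner_apply, Fin.sum_univ_succ, mul_comm]

theorem measurePreserving_consVec (d : ℕ) :
    MeasurePreserving (fun p : ℝ × EuclideanSpace ℝ (Fin d) => consVec p.1 p.2)
      ((gaussianReal 0 1).prod (stdGaussian (EuclideanSpace ℝ (Fin d))))
      (stdGaussian (EuclideanSpace ℝ (Fin (d + 1)))) := by
  have htoLp : ∀ d : ℕ, MeasurePreserving (MeasurableEquiv.toLp 2 (Fin d → ℝ))
      (Measure.pi fun _ => gaussianReal 0 1) (stdGaussian (EuclideanSpace ℝ (Fin d))) :=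
    fun d => ⟨by fun_prop, map_pi_eq_stdGaussian⟩
  have hcons := (measurePreserving_piFinSuccAbove
    (fun _ : Fin (d + 1) => gaussianReal 0 1) 0).symm
  convert ((htoLp (d + 1)).comp hcons).comp ((MeasurePreserving.id _).prod (htoLp d).symm) using 1
  ext p
  simp [consVec, MeasurableEquiv.piFinSuccAbove]

theorem measurePreserving_pi_consVec (n d : ℕ) :
    MeasurePreserving
      (fun (p : (Fin n → ℝ) × (Fin n → EuclideanSpace ℝ (Fin d))) i => consVec (p.1 i) (p.2 i))
      ((Measure.pi fun _ => gaussianReal 0 1).prod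
        (Measure.pi fun _ => stdGaussian (EuclideanSpace ℝ (Fin d))))
      (Measure.pi fun _ => stdGaussian (EuclideanSpace ℝ (Fin (d + 1)))) :=
  (measurePreserving_pi _ _ fun _ => measurePreserving_consVec d).comp
    (measurePreserving_arrowProdEquivProdArrow ℝ (EuclideanSpace ℝ (Fin d)) (Fin n)
      (fun _ => gaussianReal 0 1) fun _ => stdGaussian (EuclideanSpace ℝ (Fin d))).symm

theorem exists_linearIsometryEquiv_eq_consVec {d : ℕ} {x : EuclideanSpace ℝ (Fin (d + 1))} {t : ℝ}
    (ht : |t| = ‖x‖) :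
    ∃ U : EuclideanSpace ℝ (Fin (d + 1)) ≃ₗᵢ[ℝ] EuclideanSpace ℝ (Fin (d + 1)),
      U x = consVec t 0 := by
  refine ⟨_, Submodule.reflection_sub (v := x) (w := consVec t 0) ?_⟩
  rw [← sq_eq_sq₀ (norm_nonneg _) (norm_nonneg _), ← real_inner_self_eq_norm_sq (consVec _ _),
    inner_consVec, inner_zero_left, add_zero, ← ht, sq_abs, sq]

theorem map_mem_pairEvent_iff {σ : ℝ} {n d : ℕ} {A : Fin n → Fin n → ℝ}
    (U : EuclideanSpace ℝ (Fin d) ≃ₗᵢ[ℝ] EuclideanSpace ℝ (Fin d))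
    {x : Fin n → EuclideanSpace ℝ (Fin d)} :
    (fun i => U (x i)) ∈ pairEvent σ d A ↔ x ∈ pairEvent σ d A := by
  simp [pairEvent]

-- By rotation invariance `x` may be assumed to lie on the first axis, at `σ ‖x‖`.
theorem measure_pairEvent_cons_le {σ : ℝ} (hσ : |σ| = 1) {n d : ℕ}
    (A : Fin (n + 1) → Fin (n + 1) → ℝ) (x : EuclideanSpace ℝ (Fin (d + 1))) :
    (Measure.pi fun _ => stdGaussian (EuclideanSpace ℝ (Fin (d + 1))))
        {y | (Fin.cons x y : Fin (n + 1) → _) ∈ pairEvent σ (d + 1) A}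
      ≤ ∫⁻ z in {z : Fin n → ℝ | ∀ j, ‖x‖ * z j ≤ A 0 j.succ},
          (Measure.pi fun _ => stdGaussian (EuclideanSpace ℝ (Fin d)))
            (pairEvent σ d fun i j => A i.succ j.succ - σ * (z i * z j))
          ∂Measure.pi (fun _ => gaussianReal 0 1) := by
  have hσσ : σ * σ = 1 := by rw [← sq, ← sq_abs, hσ, one_pow]
  obtain ⟨U, hU⟩ := exists_linearIsometryEquiv_eq_consVec (x := x) (t := σ * ‖x‖)
    (by rw [abs_mul, hσ, one_mul, abs_norm])
  have hrotate := measurePreserving_pi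
    (fun _ : Fin n => stdGaussian (EuclideanSpace ℝ (Fin (d + 1)))) _ fun _ =>
      (⟨by fun_prop, stdGaussian_map U⟩ : MeasurePreserving U _ _)
  have hsplit := measurePreserving_pi_consVec n d
  set S := {y : Fin n → EuclideanSpace ℝ (Fin (d + 1)) |
    ∀ j, σ * inner ℝ (U x) (y j) ≤ A 0 j.succ} ∩
      pairEvent σ (d + 1) fun i j => A i.succ j.succ with hS
  have hSmeas : MeasurableSet S :=
    .inter (by measurability) (measurableSet_pairEvent σ (d + 1) _)
  have hpreimage : {y | (Fin.cons x y : Fin (n + 1) → _) ∈ pairEvent σ (d + 1) A}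
      = (fun y i => U (y i)) ⁻¹' S := by
    ext y
    simp [cons_mem_pairEvent, hS, map_mem_pairEvent_iff]
  rw [hpreimage, hrotate.measure_preimage hSmeas.nullMeasurableSet,
    ← hsplit.measure_preimage hSmeas.nullMeasurableSet,
    Measure.prod_apply (hsplit.measurable hSmeas), ← lintegral_indicator (by measurability)]
  refine lintegral_mono fun z => ?_
  have hmem : ∀ w : Fin n → EuclideanSpace ℝ (Fin d), (fun i => consVec (z i) (w i)) ∈ S →
      (∀ j, ‖x‖ * z j ≤ A 0 j.succ) ∧
        w ∈ pairEvent σ d fun i j => A i.succ j.succ - σ * (z i * z j) := by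
    simp only [hS, hU, mem_inter_iff, mem_ofPred_eq, inner_consVec, inner_zero_left,
      add_zero, pairEvent]
    refine fun w hw => ⟨fun j => ?_, fun i j hij => by linarith [hw.2 i j hij]⟩
    simpa [← mul_assoc, hσσ] using hw.1 j
  by_cases hz : ∀ j, ‖x‖ * z j ≤ A 0 j.succ
  · rw [indicator_of_mem (mem_ofPred.2 hz)]
    exact measure_mono fun w hw => (hmem w hw).2
  · rw [indicator_of_notMem (mt mem_ofPred.1 hz)]
    exact (measure_mono_null (fun w hw => hz (hmem w hw).1) measure_empty).le

theorem measure_pairEvent_succ_le {σ : ℝ} (hσ : |σ| = 1) {n d : ℕ}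
    (A : Fin (n + 1) → Fin (n + 1) → ℝ) :
    (Measure.pi fun _ => stdGaussian (EuclideanSpace ℝ (Fin (d + 1)))) (pairEvent σ (d + 1) A)
      ≤ ∫⁻ x, ∫⁻ z in {z : Fin n → ℝ | ∀ j, ‖x‖ * z j ≤ A 0 j.succ},
          (Measure.pi fun _ => stdGaussian (EuclideanSpace ℝ (Fin d)))
            (pairEvent σ d fun i j => A i.succ j.succ - σ * (z i * z j))
          ∂Measure.pi (fun _ => gaussianReal 0 1)
        ∂stdGaussian (EuclideanSpace ℝ (Fin (d + 1))) := by
  have : SigmaFinite (stdGaussian (EuclideanSpace ℝ (Fin (d + 1)))) := inferInstance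
  have hcons := (measurePreserving_piFinSuccAbove
    (fun _ : Fin (n + 1) => stdGaussian (EuclideanSpace ℝ (Fin (d + 1)))) 0).symm
  have hmeas := measurableSet_pairEvent σ (d + 1) A
  rw [← hcons.measure_preimage hmeas.nullMeasurableSet,
    Measure.prod_apply (hcons.measurable hmeas)]
  refine lintegral_mono fun x => ?_
  convert measure_pairEvent_cons_le hσ A x using 2
  ext y
  simp [MeasurableEquiv.piFinSuccAbove, Fin.consEquiv]

theorem measure_pairEvent_le {σ κ : ℝ} (hσ : |σ| = 1) {d₀ k : ℕ} (hk : k < d₀) {β : ℕ → ℝ}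
    (hβ : ∀ n d : ℕ, n < k → d ≤ d₀ → d₀ ≤ d + k → LayerBound σ κ n d (β n)) {n d : ℕ}
    (hd : d ≤ d₀) (hn : n ≤ k) (hdk : d₀ + n ≤ d + k) (A : Fin n → Fin n → ℝ) :
    (Measure.pi fun _ => stdGaussian (EuclideanSpace ℝ (Fin d))) (pairEvent σ d A)
      ≤ ENNReal.ofReal (exp (κ * pairSum A + ∑ i ∈ Finset.range n, β i)) := by
  induction n generalizing d with
  | zero => simpa [pairSum] using prob_le_one
  | succ n ih =>
    obtain ⟨d, rfl⟩ : ∃ e, d = e + 1 := ⟨d - 1, by omega⟩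
    refine (measure_pairEvent_succ_le hσ A).trans ?_
    have hrest : ∀ z : Fin n → ℝ, (Measure.pi fun _ => stdGaussian (EuclideanSpace ℝ (Fin d)))
          (pairEvent σ d fun i j => A i.succ j.succ - σ * (z i * z j))
        ≤ ENNReal.ofReal (exp (κ * (pairSum fun i j => A i.succ j.succ)
            + ∑ i ∈ Finset.range n, β i)) *
          ENNReal.ofReal (exp (-(σ * κ) * pairSum fun i j => z i * z j)) := by
      intro z
      refine (ih (by omega) (by omega) (by omega) _).trans_eq ?_
      rw [← ofReal_exp_add, pairSum_sub_mul]
      ring_nf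
    have hmeas : Measurable fun z : Fin n → ℝ =>
        ENNReal.ofReal (exp (-(σ * κ) * pairSum fun i j => z i * z j)) := by
      simp only [pairSum_mul]
      fun_prop
    refine (lintegral_mono fun x => lintegral_mono hrest).trans ?_
    simp_rw [lintegral_const_mul _ hmeas]
    rw [lintegral_const_mul' _ _ ENNReal.ofReal_ne_top]
    have hlayer := hβ n (d + 1) (by omega) hd (by omega) fun j => A 0 j.succ
    refine (mul_le_mul_right hlayer _).trans_eq ?_
    rw [← ofReal_exp_add, pairSum_succ, Finset.sum_range_succ]
    ring_nf

/-! ### Exponential rates -/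

open scoped MatrixOrder in
theorem multivariateGaussian_zero_one_div_smul_one (d : ℕ) :
    multivariateGaussian (0 : EuclideanSpace ℝ (Fin d))
        ((1 / (d : ℝ)) • (1 : Matrix (Fin d) (Fin d) ℝ))
      = (stdGaussian (EuclideanSpace ℝ (Fin d))).map fun x => (√d)⁻¹ • x := by
  have hsqrt : CFC.sqrt ((1 / (d : ℝ)) • (1 : Matrix (Fin d) (Fin d) ℝ)) = (√d)⁻¹ • 1 := by
    apply CFC.sqrt_unique
    · rw [smul_mul_smul_comm, one_mul, ← mul_inv, mul_self_sqrt d.cast_nonneg, one_div]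
    · exact (Matrix.PosSemidef.one.smul (by positivity)).nonneg
  rw [multivariateGaussian, hsqrt]
  congr 1
  ext x
  simp

theorem gaussVectors_pairEvent (σ t : ℝ) (n : ℕ) {d : ℕ} (hd : 0 < d) :
    gaussVectors n d (pairEvent σ d fun _ _ => t / √d)
      = (Measure.pi fun _ => stdGaussian (EuclideanSpace ℝ (Fin d)))
        (pairEvent σ d fun _ _ : Fin n => t * √d) := by
  have hscale := measurePreserving_pi (fun _ : Fin n => stdGaussian (EuclideanSpace ℝ (Fin d))) _
    fun _ => (⟨by fun_prop, (multivariateGaussian_zero_one_div_smul_one d).symm⟩ :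
      MeasurePreserving (fun x => (√d)⁻¹ • x) _ _)
  have hd' : 0 < √(d : ℝ) := sqrt_pos.2 (mod_cast hd)
  rw [gaussVectors, ← hscale.measure_preimage (measurableSet_pairEvent _ _ _).nullMeasurableSet]
  congr 1
  ext x
  simp only [pairEvent, mem_preimage, mem_ofPred_eq, real_inner_smul_left, real_inner_smul_right]
  refine forall_congr' fun i => forall_congr' fun j => imp_congr_right fun _ => ?_
  have hdiv : σ * ((√d)⁻¹ * ((√d)⁻¹ * inner ℝ (x i) (x j)))
      = σ * inner ℝ (x i) (x j) / √d / √d := by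
    field_simp
  rw [hdiv, div_le_div_iff_of_pos_right hd', div_le_iff₀ hd']

instance (n d : ℕ) : IsProbabilityMeasure (gaussVectors n d) := by
  unfold gaussVectors
  infer_instance

theorem probRed_le (n d : ℕ) (p : ℝ) :
    probRed n d p
      ≤ (gaussVectors n d).real (pairEvent 1 d fun _ _ => -gaussThreshold p / √d) := by
  refine measureReal_mono fun x hx i j hij => ?_
  have hij' := hx (mem_univ i) (mem_univ j) hij.ne
  simp only [geomGraph, not_and, not_le] at hij'
  rw [one_mul]
  exact (hij' hij.ne).le

theorem probBlue_le (n d : ℕ) (p : ℝ) :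
    probBlue n d p
      ≤ (gaussVectors n d).real (pairEvent (-1) d fun _ _ => gaussThreshold p / √d) := by
  refine measureReal_mono fun x hx i j hij => ?_
  have hij' : -gaussThreshold p / √d ≤ _ := (hx (mem_univ i) (mem_univ j) hij.ne).2
  rw [neg_div] at hij'
  linarith

theorem sum_sliceExponent (σ κ Λ m : ℝ) (n : ℕ) :
    ∑ i ∈ Finset.range n, sliceExponent σ κ Λ m i
      = n.choose 2 * (Λ - σ * κ * m ^ 2 * (2 * n - 1) / 6 + κ ^ 2 * m ^ 2 * n.choose 2) := by
  rw [Nat.cast_choose_two]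
  induction n with
  | zero => simp
  | succ n ih =>
    rw [Finset.sum_range_succ, ih, sliceExponent]
    push_cast
    ring

/-- The exponential rate, per pair of vectors, of the upper bound for the probability that the
normalised inner products `√d ⟪x i, x j⟫` all lie on the side of a threshold given by `σ` and `t`,
when the number of vectors is `ρ √d`. It is built from the tangent of `log Φ` at `θ`. -/
noncomputable def rate (σ θ t ρ : ℝ) : ℝ :=
  log (gaussCDF θ) + hazard θ * (t - θ) - σ * hazard θ ^ 3 * ρ / 3 + hazard θ ^ 4 * ρ ^ 2 / 2

theorem add_sum_sliceExponent_le_rate {σ : ℝ} (hσ : |σ| = 1) (θ t : ℝ) {n d : ℕ} (hd : 0 < d)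
    (hn : hazard θ * (n / √d) ≤ 1 / 2) :
    hazard θ / √d * (n.choose 2 * (t * √d))
        + ∑ i ∈ Finset.range n,
          sliceExponent σ (hazard θ / √d) (log (gaussCDF θ) - hazard θ * θ) (hazard θ) i
      ≤ n.choose 2 * rate σ θ t (n / √d) + n * hazard θ ^ 2 := by
  have : 0 < √(d : ℝ) := sqrt_pos.2 (mod_cast hd)
  have hm := hazard_pos θ
  set m := hazard θ with hm_def
  obtain ⟨κ, hκ, hm_eq⟩ : ∃ κ, 0 ≤ κ ∧ m = κ * √d := ⟨m / √d, by positivity, by field_simp⟩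
  have hκ_eq : m / √d = κ := by rw [hm_eq]; field_simp
  have hnκ : m * (n / √d) = n * κ := by rw [← hκ_eq]; ring
  rw [hnκ] at hn
  have hchoose : (n.choose 2 : ℝ) ≤ n ^ 2 / 2 := by
    rw [Nat.cast_choose_two]
    nlinarith [n.cast_nonneg (α := ℝ)]
  have hrate : rate σ θ t (n / √d) = log (gaussCDF θ) + m * (t - θ) - σ * m ^ 2 * (n * κ) / 3
      + m ^ 2 * (n * κ) ^ 2 / 2 := by
    rw [rate, ← hnκ, ← hm_def]
    ring
  have hcubic : σ * (n.choose 2 * κ * m ^ 2) ≤ 1 * (n ^ 2 / 2 * κ * m ^ 2) := by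
    gcongr
    exact (le_abs_self σ).trans hσ.le
  have hlinear : n * m ^ 2 * (n * κ) ≤ n * m ^ 2 * (1 / 2) := by gcongr
  have hquartic : n.choose 2 * (κ ^ 2 * m ^ 2 * n.choose 2)
      ≤ n.choose 2 * (κ ^ 2 * m ^ 2 * (n ^ 2 / 2)) := by gcongr
  have hconst : κ * (n.choose 2 * (t * √d)) = n.choose 2 * (m * t) := by rw [hm_eq]; ring
  have : 0 ≤ n * m ^ 2 := by positivity
  rw [hκ_eq, sum_sliceExponent, hrate, hconst]
  linarith

theorem exists_gaussVectors_pairEvent_le (θ : ℝ) : ∃ B κ₀ : ℝ, 0 < κ₀ ∧ ∀ σ t : ℝ, ∀ n d : ℕ,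
    |σ| = 1 → n < d → hazard θ / √d ≤ κ₀ → hazard θ * (n / √d) ≤ 1 / 2 →
    (gaussVectors n d).real (pairEvent σ d fun _ _ => t / √d)
      ≤ exp (n.choose 2 * rate σ θ t (n / √d) + n * B) := by
  obtain ⟨B, κ₀, hκ₀, hlayer⟩ := exists_layerBound θ
  refine ⟨hazard θ ^ 2 + B, κ₀, hκ₀, fun σ t n d hσ hnd hd hn => ?_⟩
  have hd0 : 0 < d := by omega
  have hm := hazard_pos θ
  have hκ : 0 ≤ hazard θ / √d := by positivity
  have hκ2 : (hazard θ / √d) ^ 2 * d = hazard θ ^ 2 := by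
    rw [div_pow, sq_sqrt d.cast_nonneg]
    field_simp
  have hnκ : n * (hazard θ / √d) ≤ 1 / 2 := by rwa [mul_div_left_comm] at hn
  refine ENNReal.toReal_le_of_le_ofReal (exp_pos _).le ?_
  rw [gaussVectors_pairEvent σ t n hd0]
  refine (measure_pairEvent_le hσ hnd (fun i d' hi hd' hdd =>
    hlayer σ _ i n d' d hσ hκ hd hκ2 hnκ hi.le hd' hdd) le_rfl le_rfl le_rfl _).trans ?_
  refine ENNReal.ofReal_le_ofReal (exp_le_exp.2 ?_)
  rw [pairSum_const, Finset.sum_add_distrib, Finset.sum_const, Finset.card_range, nsmul_eq_mul]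
  linarith [add_sum_sliceExponent_le_rate hσ θ t hd0 hn]

theorem eventually_gaussVectors_pairEvent_le_pow {α : Type*} {F : Filter α} {n d : α → ℕ}
    {σ θ t ρ y : ℝ} (hσ : |σ| = 1) (hn : Tendsto n F atTop) (hd : Tendsto d F atTop)
    (hρ : Tendsto (fun a => n a / √(d a)) F (𝓝 ρ)) (hρθ : hazard θ * ρ < 1 / 2) (hy : 0 < y)
    (hrate : rate σ θ t ρ < log y) :
    ∀ᶠ a in F, (gaussVectors (n a) (d a)).real (pairEvent σ (d a) fun _ _ => t / √(d a))
      ≤ y ^ (n a).choose 2 := by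
  obtain ⟨B, κ₀, hκ₀, hprob⟩ := exists_gaussVectors_pairEvent_le θ
  have hsqrt : Tendsto (fun a => √(d a)) F atTop :=
    tendsto_sqrt_atTop.comp (tendsto_natCast_atTop_atTop.comp hd)
  have hκ : ∀ᶠ a in F, hazard θ / √(d a) < κ₀ :=
    (hsqrt.const_div_atTop (hazard θ)).eventually_lt_const hκ₀
  have hexponent : Tendsto (fun a => rate σ θ t (n a / √(d a)) + 2 * B / ((n a : ℝ) - 1)) F
      (𝓝 (rate σ θ t ρ + 0)) := by
    refine Tendsto.add ?_ (Tendsto.const_div_atTop ?_ _)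
    · have hcont : Continuous (rate σ θ t) := by unfold rate; fun_prop
      exact (hcont.tendsto ρ).comp hρ
    · exact tendsto_atTop_add_const_right F (-1) (tendsto_natCast_atTop_atTop.comp hn)
  rw [add_zero] at hexponent
  filter_upwards [hκ, (hρ.const_mul _).eventually_le_const hρθ, hexponent.eventually_le_const hrate,
    hn.eventually_ge_atTop 2, hρ.eventually_le_const (lt_add_one ρ),
    hsqrt.eventually_gt_atTop (max (ρ + 1) 0)] with a hκa hρθa hrate_a hna hρa hda
  obtain ⟨hda, hda0⟩ := max_lt_iff.1 hda
  have hnd : n a < d a := by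
    have : (n a : ℝ) < √(d a) * √(d a) :=
      (div_lt_iff₀ hda0).1 (hρa.trans_lt hda)
    rw [mul_self_sqrt (Nat.cast_nonneg _)] at this
    exact_mod_cast this
  refine (hprob σ t (n a) (d a) hσ hnd hκa.le hρθa).trans ?_
  have hna1 : (0 : ℝ) < n a - 1 := by
    have : (2 : ℝ) ≤ n a := mod_cast hna
    linarith
  have hsplit : (n a : ℝ) * B = (n a).choose 2 * (2 * B / ((n a : ℝ) - 1)) := by
    rw [Nat.cast_choose_two]
    field_simp
  rw [hsplit, ← mul_add, ← exp_log (pow_pos hy _), log_pow]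
  exact exp_le_exp.2 (by gcongr)

theorem eventually_probRed_le_pow {α : Type*} {F : Filter α} {n d : α → ℕ} {θ p ρ y : ℝ}
    (hn : Tendsto n F atTop) (hd : Tendsto d F atTop)
    (hρ : Tendsto (fun a => n a / √(d a)) F (𝓝 ρ)) (hρθ : hazard θ * ρ < 1 / 2) (hy : 0 < y)
    (hrate : rate 1 θ (-gaussThreshold p) ρ < log y) :
    ∀ᶠ a in F, probRed (n a) (d a) p ≤ y ^ (n a).choose 2 :=
  (eventually_gaussVectors_pairEvent_le_pow abs_one hn hd hρ hρθ hy hrate).mono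
    fun _ ha => (probRed_le _ _ p).trans ha

theorem eventually_probBlue_le_pow {α : Type*} {F : Filter α} {n d : α → ℕ} {θ p ρ y : ℝ}
    (hn : Tendsto n F atTop) (hd : Tendsto d F atTop)
    (hρ : Tendsto (fun a => n a / √(d a)) F (𝓝 ρ)) (hρθ : hazard θ * ρ < 1 / 2) (hy : 0 < y)
    (hrate : rate (-1) θ (gaussThreshold p) ρ < log y) :
    ∀ᶠ a in F, probBlue (n a) (d a) p ≤ y ^ (n a).choose 2 :=
  (eventually_gaussVectors_pairEvent_le_pow (by simp) hn hd hρ hρθ hy hrate).mono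
    fun _ ha => (probBlue_le _ _ p).trans ha

/-! ### The choice of the threshold -/

theorem sq_mul_neg_log_lt {q : ℝ} (h0 : 0 < q) (h1 : q < 1 / 2) :
    q ^ 2 * -log q < (1 - q) ^ 2 * -log (1 - q) := by
  let G : ℝ → ℝ := fun x => (1 - x) * negMulLog (1 - x) - x * negMulLog x
  have hderiv : ∀ x ∈ Ioo (0 : ℝ) 2⁻¹, HasDerivAt G (1 - 2 * binEntropy x) x := by
    intro x hx
    have hx1 : (1 : ℝ) - x ≠ 0 := by linarith [hx.2]
    have hsub : HasDerivAt (fun x : ℝ => 1 - x) (-1) x := (hasDerivAt_id x).const_sub 1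
    refine ((hsub.mul ((hasDerivAt_negMulLog hx1).comp x hsub)).sub
      ((hasDerivAt_id x).mul (hasDerivAt_negMulLog hx.1.ne'))).congr_deriv ?_
    rw [binEntropy_eq_negMulLog_add_negMulLog_one_sub]
    simp only [negMulLog, Function.comp_apply, id]
    ring
  have hanti : StrictAntiOn (deriv G) (Ioo 0 2⁻¹) := by
    intro x hx y hy hxy
    rw [(hderiv x hx).deriv, (hderiv y hy).deriv]
    linarith [binEntropy_strictMonoOn (Ioo_subset_Icc_self hx) (Ioo_subset_Icc_self hy) hxy]
  have hconcave : StrictConcaveOn ℝ (Icc (0 : ℝ) 2⁻¹) G :=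
    StrictAntiOn.strictConcaveOn_of_deriv (convex_Icc _ _) (by fun_prop) (by rwa [interior_Icc])
  have hpos := hconcave.lt_on_openSegment (x := 0) (y := 2⁻¹) (z := q) (by simp) (by simp)
    (by norm_num) (by rw [openSegment_eq_Ioo (by norm_num)]; exact ⟨h0, by linarith⟩)
  norm_num [G, negMulLog] at hpos
  linarith

theorem IsErdosProb.mul_sq_lt {C q : ℝ} (h : IsErdosProb C q) : C * q ^ 2 < (1 - q) ^ 2 := by
  obtain ⟨h0, h1, hC⟩ := h
  have hlog : log (1 - q) < 0 := log_neg (by linarith) (by linarith)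
  have hmul : log q = C * log (1 - q) := by rw [hC, div_mul_cancel₀ _ hlog.ne]
  refine lt_of_mul_lt_mul_right ?_ (neg_pos.2 hlog).le
  calc C * q ^ 2 * -log (1 - q) = q ^ 2 * -log q := by rw [hmul]; ring
    _ < (1 - q) ^ 2 * -log (1 - q) := sq_mul_neg_log_lt h0 h1

theorem IsErdosProb.mul_hazard_sq_lt {C q c : ℝ} (h : IsErdosProb C q) (hc : gaussCDF (-c) = q) :
    C * hazard c ^ 2 < hazard (-c) ^ 2 := by
  have hratio : hazard (-c) * q = hazard c * (1 - q) := hc ▸ hazard_mul_gaussCDF_neg c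
  have hpos := hazard_pos (-c)
  refine lt_of_mul_lt_mul_right ?_ (sq_nonneg (1 - q))
  calc C * hazard c ^ 2 * (1 - q) ^ 2 = hazard (-c) ^ 2 * (C * q ^ 2) := by
        rw [mul_assoc, ← mul_pow, ← hratio]
        ring
    _ < hazard (-c) ^ 2 * (1 - q) ^ 2 := by
        gcongr
        exact h.mul_sq_lt

theorem eventually_rate_lt_log_gaussCDF {σ θ s r : ℝ} (h : s < σ * hazard θ ^ 2 * r / 3) :
    ∀ᶠ i in 𝓝[>] 0, rate σ θ (θ + s * i) (r * i) < log (gaussCDF θ) := by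
  have hcont : Tendsto (fun i => s - σ * hazard θ ^ 2 * r / 3 + hazard θ ^ 3 * r ^ 2 * i / 2)
      (𝓝[>] 0) (𝓝 (s - σ * hazard θ ^ 2 * r / 3 + hazard θ ^ 3 * r ^ 2 * 0 / 2)) :=
    ((by fun_prop : Continuous _).tendsto 0).mono_left nhdsWithin_le_nhds
  filter_upwards [hcont.eventually_lt_const (u := 0) (by linarith), self_mem_nhdsWithin]
    with i hneg hi
  have hprod := mul_neg_of_pos_of_neg (mul_pos (mem_Ioi.1 hi) (hazard_pos θ)) hneg
  rw [rate]
  linarith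

theorem eventually_hazard_mul_lt_half (θ r : ℝ) : ∀ᶠ i in 𝓝[>] 0, hazard θ * (r * i) < 1 / 2 := by
  have hcont : Tendsto (fun i => hazard θ * (r * i)) (𝓝[>] 0) (𝓝 (hazard θ * (r * 0))) :=
    ((by fun_prop : Continuous _).tendsto 0).mono_left nhdsWithin_le_nhds
  exact hcont.eventually_lt_const (by simp)

theorem IsGaussThreshold.gaussThreshold_eq {p c : ℝ} (h : IsGaussThreshold p c) :
    0 < p ∧ p < 1 / 2 ∧ gaussThreshold p = c := by
  have h0 : 0 < p := h.2 ▸ gaussCDF_pos (-c)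
  have h1 : p < 1 / 2 := by
    rw [← gaussianReal_Iic_zero, ← h.2]
    exact gaussianReal_Iic_strictMono (neg_neg_of_pos h.1)
  exact ⟨h0, h1, (existsUnique_isGaussThreshold h0 h1).unique (gaussThreshold_spec h0 h1) h⟩

theorem exists_lt_log_sub {x y u v : ℝ} (hx : 0 < x) (hy : 0 < y) (hu : u < log x)
    (hv : v < log y) : ∃ ε, 0 < ε ∧ ε < x ∧ u < log (x - ε) ∧ v < log (y - ε) := by
  have hlog : ∀ z, 0 < z → Tendsto (fun ε => log (z - ε)) (𝓝[>] 0) (𝓝 (log z)) := fun z hz => by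
    have hcont : ContinuousAt (fun ε => log (z - ε)) 0 :=
      ContinuousAt.log (by fun_prop) (by simpa using hz.ne')
    simpa using hcont.tendsto.mono_left nhdsWithin_le_nhds
  have hpos : ∀ᶠ ε : ℝ in 𝓝[>] 0, 0 < ε := self_mem_nhdsWithin
  obtain ⟨ε, hε, hεx, huε, hvε⟩ := (hpos.and
    (((eventually_lt_nhds hx).filter_mono nhdsWithin_le_nhds).and
      (((hlog x hx).eventually_const_lt hu).and ((hlog y hy).eventually_const_lt hv)))).exists
  exact ⟨ε, hε, hεx, huε, hvε⟩

-- The threshold is lowered by `η * i`, where the gains in both rates leave room for `η`.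
theorem eventually_exists_rate_lt {C : ℝ} (hC : 1 < C) :
    ∀ᶠ i in 𝓝[>] 0, ∃ ε p : ℝ, 0 < ε ∧ ε < erdosProb C ∧ 0 < p ∧ p < 1 / 2 ∧
      rate 1 (-gaussThreshold (erdosProb C)) (-gaussThreshold p) i < log (erdosProb C - ε) ∧
      rate (-1) (gaussThreshold (erdosProb C)) (gaussThreshold p) (C * i)
        < log (1 - erdosProb C - ε) := by
  have hq := erdosProb_spec hC
  set q := erdosProb C
  obtain ⟨hc, hcq⟩ := gaussThreshold_spec hq.1 hq.2.1
  set c := gaussThreshold q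
  have hΦ : gaussCDF c = 1 - q := by rw [← hcq, ← gaussCDF, gaussCDF_neg, sub_sub_cancel]
  obtain ⟨η, hη_blue, hη_red⟩ := exists_between
    (div_lt_div_of_pos_right (hq.mul_hazard_sq_lt hcq) three_pos)
  have hred := eventually_rate_lt_log_gaussCDF (σ := 1) (θ := -c) (s := η) (r := 1) (by linarith)
  have hblue := eventually_rate_lt_log_gaussCDF (σ := -1) (θ := c) (s := -η) (r := C) (by linarith)
  have hshift : Tendsto (fun i => c - η * i) (𝓝[>] 0) (𝓝 (c - η * 0)) :=
    ((by fun_prop : Continuous _).tendsto 0).mono_left nhdsWithin_le_nhds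
  filter_upwards [hred, hblue, hshift.eventually_const_lt (u := 0) (by linarith)]
    with i hi_red hi_blue hi
  rw [gaussCDF, hcq, one_mul] at hi_red
  rw [hΦ] at hi_blue
  obtain ⟨hp0, hp1, hp⟩ := IsGaussThreshold.gaussThreshold_eq
    (p := gaussCDF (-(c - η * i))) ⟨hi, rfl⟩
  obtain ⟨ε, hε, hεq, hε_red, hε_blue⟩ :=
    exists_lt_log_sub hq.1 (by linarith [hq.2.1]) hi_red hi_blue
  refine ⟨ε, _, hε, hεq, hp0, hp1, ?_, ?_⟩
  · rwa [hp, neg_sub, sub_eq_neg_add]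
  · rwa [hp, sub_eq_add_neg, ← neg_mul]

/-! ### The regime `ℓ → ∞` -/

section RatioLimits

variable {α : Type*} {F : Filter α} {u v : α → ℝ} {a : ℝ}

theorem tendsto_div_of_abs_sub_mul_lt (hu : Tendsto u F atTop)
    (h : ∀ᶠ x in F, |v x - a * u x| < 1) : Tendsto (fun x => v x / u x) F (𝓝 a) := by
  rw [tendsto_iff_norm_sub_tendsto_zero]
  refine squeeze_zero' (.of_forall fun x => norm_nonneg _) ?_ (tendsto_inv_atTop_zero.comp hu)
  filter_upwards [h, hu.eventually_gt_atTop 0] with x hx hux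
  rw [norm_eq_abs, Function.comp_apply, div_sub' hux.ne', abs_div, abs_of_pos hux, mul_comm (u x),
    ← one_div]
  gcongr

theorem tendsto_atTop_of_abs_sub_mul_lt (ha : 0 < a) (hu : Tendsto u F atTop)
    (h : ∀ᶠ x in F, |v x - a * u x| < 1) : Tendsto v F atTop := by
  refine tendsto_atTop_mono' F ?_ (tendsto_atTop_add_const_right F (-1) (hu.const_mul_atTop ha))
  filter_upwards [h] with x hx
  linarith [(abs_lt.1 hx).1]

end RatioLimits

/-- The regime `ℓ → ∞` of triples `(ℓ, d, k)` in which `d` and `k` are the integers nearest to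
`D ^ 2 * ℓ ^ 2` and `C * ℓ` from below or above. -/
def ramseyFilter (C D : ℝ) : Filter (ℕ × ℕ × ℕ) :=
  comap Prod.fst atTop ⊓ 𝓟 {t | |(t.2.1 : ℝ) - D ^ 2 * (t.1 : ℝ) ^ 2| < 1 ∧
    |(t.2.2 : ℝ) - C * (t.1 : ℝ)| < 1}

namespace ramseyFilter

variable {C D : ℝ}

theorem exists_forall_of_eventually {P : ℕ × ℕ × ℕ → Prop} (h : ∀ᶠ t in ramseyFilter C D, P t) :
    ∃ L : ℕ, ∀ ℓ : ℕ, L ≤ ℓ → ∀ d k : ℕ, |(d : ℝ) - D ^ 2 * (ℓ : ℝ) ^ 2| < 1 →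
      |(k : ℝ) - C * (ℓ : ℝ)| < 1 → P (ℓ, d, k) := by
  rw [ramseyFilter, eventually_inf_principal, eventually_comap] at h
  obtain ⟨L, hL⟩ := eventually_atTop.1 h
  exact ⟨L, fun ℓ hℓ d k hd hk => hL ℓ hℓ (ℓ, d, k) rfl ⟨hd, hk⟩⟩

theorem eventually_abs_sub_lt : ∀ᶠ t in ramseyFilter C D,
    |(t.2.1 : ℝ) - D ^ 2 * (t.1 : ℝ) ^ 2| < 1 ∧ |(t.2.2 : ℝ) - C * (t.1 : ℝ)| < 1 :=
  mem_inf_of_right (mem_principal_self _)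

theorem tendsto_fst : Tendsto (fun t => t.1) (ramseyFilter C D) atTop :=
  tendsto_comap.mono_left inf_le_left

theorem tendsto_natCast_fst : Tendsto (fun t => (t.1 : ℝ)) (ramseyFilter C D) atTop :=
  tendsto_natCast_atTop_atTop.comp tendsto_fst

theorem tendsto_natCast_fst_sq : Tendsto (fun t => (t.1 : ℝ) ^ 2) (ramseyFilter C D) atTop :=
  (tendsto_pow_atTop two_ne_zero).comp tendsto_natCast_fst

theorem tendsto_snd_fst (hD : 0 < D) : Tendsto (fun t => t.2.1) (ramseyFilter C D) atTop :=
  tendsto_natCast_atTop_iff.1 (tendsto_atTop_of_abs_sub_mul_lt (sq_pos_of_pos hD)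
    tendsto_natCast_fst_sq (eventually_abs_sub_lt.mono fun _ ht => ht.1))

theorem tendsto_snd_snd (hC : 0 < C) : Tendsto (fun t => t.2.2) (ramseyFilter C D) atTop :=
  tendsto_natCast_atTop_iff.1 (tendsto_atTop_of_abs_sub_mul_lt hC tendsto_natCast_fst
    (eventually_abs_sub_lt.mono fun _ ht => ht.2))

theorem tendsto_fst_div_sqrt (hD : 0 < D) :
    Tendsto (fun t => (t.1 : ℝ) / √t.2.1) (ramseyFilter C D) (𝓝 D⁻¹) := by
  have hsq := tendsto_div_of_abs_sub_mul_lt (tendsto_natCast_fst_sq (C := C) (D := D))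
    (eventually_abs_sub_lt.mono fun _ ht => ht.1)
  have hsqrt := hsq.sqrt.inv₀ (sqrt_pos.2 (sq_pos_of_pos hD)).ne'
  simpa [sqrt_sq hD.le, sqrt_sq] using hsqrt

theorem tendsto_snd_snd_div_sqrt (hD : 0 < D) :
    Tendsto (fun t => (t.2.2 : ℝ) / √t.2.1) (ramseyFilter C D) (𝓝 (C * D⁻¹)) := by
  have hratio := tendsto_div_of_abs_sub_mul_lt (tendsto_natCast_fst (C := C) (D := D))
    (eventually_abs_sub_lt.mono fun _ ht => ht.2)
  refine (hratio.mul (tendsto_fst_div_sqrt hD)).congr' ?_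
  filter_upwards [tendsto_natCast_fst.eventually_gt_atTop 0] with t ht
  field_simp

end ramseyFilter

end GaussRamsey

theorem lemma3 (C : ℝ) (hC : 1 < C) :
    ∃ D₀ : ℝ, 0 < D₀ ∧ ∀ D : ℝ, D₀ ≤ D →
      ∃ ε₁ p : ℝ, 0 < ε₁ ∧ ε₁ < GaussRamsey.erdosProb C ∧ 0 < p ∧ p < 1 / 2 ∧
        ∃ L : ℕ, ∀ ℓ : ℕ, L ≤ ℓ → ∀ d k : ℕ,
          |(d : ℝ) - D ^ 2 * (ℓ : ℝ) ^ 2| < 1 → |(k : ℝ) - C * (ℓ : ℝ)| < 1 →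
            GaussRamsey.probRed ℓ d p ≤ (GaussRamsey.erdosProb C - ε₁) ^ ℓ.choose 2 ∧
            GaussRamsey.probBlue k d p ≤
              (1 - GaussRamsey.erdosProb C - ε₁) ^ k.choose 2 := by
  open GaussRamsey Filter in
  obtain ⟨-, hq1, -⟩ := erdosProb_spec hC
  obtain ⟨D₀, hD₀⟩ := eventually_atTop.1 <| tendsto_inv_atTop_nhdsGT_zero.eventually <|
    (eventually_exists_rate_lt hC).and <|
      (eventually_hazard_mul_lt_half (-gaussThreshold (erdosProb C)) 1).and
        (eventually_hazard_mul_lt_half (gaussThreshold (erdosProb C)) C)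
  refine ⟨max D₀ 1, by positivity, fun D hD => ?_⟩
  have hD0 : 0 < D := one_pos.trans_le ((le_max_right _ _).trans hD)
  obtain ⟨⟨ε, p, hε, hεq, hp0, hp1, hrate_red, hrate_blue⟩, hhazard_red, hhazard_blue⟩ :=
    hD₀ D ((le_max_left _ _).trans hD)
  rw [one_mul] at hhazard_red
  have hd := ramseyFilter.tendsto_snd_fst (C := C) hD0
  have hred := eventually_probRed_le_pow ramseyFilter.tendsto_fst hd
    (ramseyFilter.tendsto_fst_div_sqrt hD0) hhazard_red (sub_pos.2 hεq) hrate_red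
  have hblue := eventually_probBlue_le_pow (ramseyFilter.tendsto_snd_snd (one_pos.trans hC)) hd
    (ramseyFilter.tendsto_snd_snd_div_sqrt hD0) hhazard_blue (by linarith) hrate_blue
  exact ⟨ε, p, hε, hεq, hp0, hp1, ramseyFilter.exists_forall_of_eventually (hred.and hblue)⟩
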